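/- Let $G=(V,E)$ be a finite connected simple graph with a cost function $c:E\to\mathbb R_+$, viewed as a bidirected graph (each edge $uv$ stands for the two arcs $uv$ and $vu$, both of cost $c(uv)$). For a set $H$ of arcs of $G$, the power of $u\in V$ is $p_H(u)=\max_{uv\in H}c(uv)$ (and $0$ if no arc of $H$ leaves $u$), and $p(H)=\sum_{u\in V}p_H(u)$. Let $\mathit{opt}$ be the minimum of $p(H)$ over all $H$ such that $(V,H)$ is strongly connected (Min-Power Strong Connectivity). Algorithm Greedy. Let $T$ be a minimum spanning tree of $G$, $\tilde T$ the set of the two arcs of each edge of $T$, and $c(T)=\sum_{e\in T}c(e)$. For $u\in V$ and $r\in\{c(uv): uv\in E\}$, let $S(u,r)$ be the star consisting of all arcs $uv$ with $c(uv)\le r$; its vertices are $u$ and the heads of these arcs. Let $Q(u,r)$ be the set of edges of $T$ on the path of $T$ between some two vertices of $S(u,r)$, and let $\hat Q(u,r)$ be the set of arcs of $\tilde T$ on the directed path of $\tilde T$ from $u$ to some vertex of $S(u,r)$. For a set $\mathcal A$ of stars let $Q(\mathcal A)=\bigcup_{S(u,r)\in\mathcal A}Q(u,r)$, $f(\mathcal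 A)=\sum_{e\in Q(\mathcal A)}c(e)$ and $f_{\mathcal A}(S)=f(\mathcal A\cup\{S\})-f(\mathcal A)$, and let $I_{\mathcal A}(S(u,r))$ be the set of arcs of $\hat Q(u,r)$ whose undirected version is not in $Q(\mathcal A)$. Start with $\mathcal A=\emptyset$ and $M=\tilde T$. While $f(\mathcal A)<c(T)$, choose a star $S=S(u,r)$ that maximizes $f_{\mathcal A}(S(u,r))/r$ (where $0/0=1$) among all stars, and replace $M$ by $M\setminus I_{\mathcal A}(S)$ and then $\mathcal A$ by $\mathcal A\cup\{S\}$. When $f(\mathcal A)\ge c(T)$, output all arcs of the stars in $\mathcal A$ together with $M$. Theorem. There is a polynomial-time algorithm for Min-Power Strong Connectivity with approximation ratio $1.85$. More precisely: (a) For every $G$ and $c$ as above, the minimum $\mathit{opt}$ exists and, for every choice of the minimum spanning tree and of the maximizing stars for which Greedy stops, its output $H$ is a set of arcs of $G$ with $(V,H)$ strongly connected, and $p(H)\le(1+\alpha+\alpha\ln(1/\alpha))\,\mathit{opt}\le 1.85\,\mathit{opt}$, where $\alpha=1/2$. (b) There are a program and a polynomial $q$ such that, for every $n$ and every $G$ and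 $c$ as above with $V=\{0,\dots,n-1\}$, the program, given $n$, the adjacency matrix and the costs, halts after at most $q(n)$ steps and returns an output $H$ of Greedy (for some choice of the minimum spanning tree and of the maximizing stars); in particular $(V,H)$ is strongly connected and $p(H)\le1.85\,\mathit{opt}$. Here a program is a while-program on a random access machine with arrays of natural numbers and arrays of real numbers, in which one step is an assignment or a test; natural numbers can be added, subtracted, compared and used as indices, and for real numbers the only operations are the constant $0$, addition, subtraction, and the tests $x\le y$ and $xy\le zw$. -/

import Mathlib

open scoped NNReal

namespace MinPower

/-! ### Bidirected graphs, power, Min-Power Strong Connectivity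

A bidirected graph is given by a simple graph `G`: its arcs are the ordered pairs `(u, v)` with
`G.Adj u v`, and both `(u, v)` and `(v, u)` have the cost `c s(u, v)`. The cost is a function
`c : Sym2 V → ℝ≥0`, of which only the values at edges of `G` are ever used. A spanning directed
subgraph is identified with its finite set of arcs. -/

/-- The set of all arcs `(u, v)`, `(v, u)` coming from the edges of a simple graph. -/
noncomputable def bidirected {V : Type*} [Fintype V] (G : SimpleGraph V) : Finset (V × V) :=
  open Classical in Finset.univ.filter (fun a => G.Adj a.1 a.2)

/-- The directed spanning subgraph with arc set `H` is strongly connected. -/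
def StronglyConnected {V : Type*} (H : Finset (V × V)) : Prop :=
  ∀ u v : V, Relation.ReflTransGen (fun x y => (x, y) ∈ H) u v

/-- `p_H(u)`: the largest cost of an arc of `H` that leaves `u` (zero if there is none). -/
noncomputable def vertexPower {V : Type*} (c : Sym2 V → ℝ≥0) (H : Finset (V × V)) (u : V) : ℝ≥0 :=
  open Classical in (H.filter (fun a => a.1 = u)).sup (fun a => c s(a.1, a.2))

/-- `p(H)`: the total power. -/
noncomputable def power {V : Type*} [Fintype V] (c : Sym2 V → ℝ≥0) (H : Finset (V × V)) : ℝ≥0 :=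
  ∑ u, vertexPower c H u

/-- A feasible solution: a strongly connected spanning directed subgraph of the bidirected `G`. -/
def IsSolution {V : Type*} [Fintype V] (G : SimpleGraph V) (H : Finset (V × V)) : Prop :=
  H ⊆ bidirected G ∧ StronglyConnected H

/-- `x` is the optimum: the least power of a feasible solution. -/
def IsOpt {V : Type*} [Fintype V] (G : SimpleGraph V) (c : Sym2 V → ℝ≥0) (x : ℝ≥0) : Prop :=
  IsLeast {y | ∃ H, IsSolution G H ∧ power c H = y} x

/-! ### Minimum spanning trees and stars -/

/-- The undirected cost `c(T)`: the sum of the costs of the edges of `T`. -/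
noncomputable def treeCost {V : Type*} [Fintype V] (c : Sym2 V → ℝ≥0) (T : SimpleGraph V) : ℝ≥0 :=
  open Classical in ∑ e ∈ Finset.univ.filter (fun e => e ∈ T.edgeSet), c e

/-- `T` is a spanning tree of `G`. -/
def IsSpanningTree {V : Type*} (G T : SimpleGraph V) : Prop :=
  T ≤ G ∧ T.IsTree

/-- `T` is a spanning tree of `G` of minimum cost. -/
def IsMST {V : Type*} [Fintype V] (G : SimpleGraph V) (c : Sym2 V → ℝ≥0) (T : SimpleGraph V) :
    Prop :=
  IsSpanningTree G T ∧ ∀ T', IsSpanningTree G T' → treeCost c T ≤ treeCost c T'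

/-- The pair `(u, r)` names a star `S(u, r)`: `r` is the cost of an arc of `G` that leaves `u`. -/
def IsStar {V : Type*} (G : SimpleGraph V) (c : Sym2 V → ℝ≥0) (S : V × ℝ≥0) : Prop :=
  ∃ v, G.Adj S.1 v ∧ c s(S.1, v) = S.2

/-- The arcs of the star `S(u, r)`: all arcs `(u, v)` of cost at most `r`. -/
noncomputable def starArcs {V : Type*} [Fintype V] (G : SimpleGraph V) (c : Sym2 V → ℝ≥0)
    (S : V × ℝ≥0) : Finset (V × V) :=
  open Classical in
  Finset.univ.filter (fun a => a.1 = S.1 ∧ G.Adj a.1 a.2 ∧ c s(a.1, a.2) ≤ S.2)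

/-- The vertices of the star `S(u, r)`: the centre and the heads of its arcs. -/
noncomputable def starVerts {V : Type*} [Fintype V] (G : SimpleGraph V) (c : Sym2 V → ℝ≥0)
    (S : V × ℝ≥0) : Finset V :=
  open Classical in insert S.1 ((starArcs G c S).image Prod.snd)

/-- `Q(S)`: the edges of `T` that lie on the path of `T` between two vertices of the star. -/
noncomputable def QStar {V : Type*} [Fintype V] (G : SimpleGraph V) (c : Sym2 V → ℝ≥0)
    (T : SimpleGraph V) (S : V × ℝ≥0) : Finset (Sym2 V) :=
  open Classical in
  Finset.univ.filter (fun e => ∃ x ∈ starVerts G c S, ∃ y ∈ starVerts G c S,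
    ∃ p : T.Walk x y, p.IsPath ∧ e ∈ p.edges)

/-- `Q̂(S)`: the arcs of the bidirected `T` that lie on the directed path of `T` from the centre of
the star to some vertex of the star. -/
noncomputable def Qhat {V : Type*} [Fintype V] (G : SimpleGraph V) (c : Sym2 V → ℝ≥0)
    (T : SimpleGraph V) (S : V × ℝ≥0) : Finset (V × V) :=
  open Classical in
  Finset.univ.filter (fun a => ∃ x ∈ starVerts G c S,
    ∃ p : T.Walk S.1 x, p.IsPath ∧ ∃ d ∈ p.darts, d.toProd = a)

/-- `Q(A)`, for a collection `A` of stars: the union of the sets `Q(S)`. -/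
noncomputable def QAll {V : Type*} [Fintype V] (G : SimpleGraph V) (c : Sym2 V → ℝ≥0)
    (T : SimpleGraph V) (A : Finset (V × ℝ≥0)) : Finset (Sym2 V) :=
  open Classical in A.biUnion (QStar G c T)

/-- `f(A)`: the total cost of `Q(A)`. -/
noncomputable def coverCost {V : Type*} [Fintype V] (G : SimpleGraph V) (c : Sym2 V → ℝ≥0)
    (T : SimpleGraph V) (A : Finset (V × ℝ≥0)) : ℝ≥0 :=
  ∑ e ∈ QAll G c T A, c e

/-- `f_A(S) = f(A ∪ {S}) - f(A)`. -/
noncomputable def gain {V : Type*} [Fintype V] (G : SimpleGraph V) (c : Sym2 V → ℝ≥0)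
    (T : SimpleGraph V) (A : Finset (V × ℝ≥0)) (S : V × ℝ≥0) : ℝ :=
  open Classical in (coverCost G c T (insert S A) : ℝ) - (coverCost G c T A : ℝ)

/-- The ratio `f_A(S(u, r)) / r`, where `0 / 0 = 1`. (If `T` is a minimum spanning tree, `r = 0`
forces `f_A(S(u, r)) = 0`, so that no other division by zero occurs.) -/
noncomputable def ratio {V : Type*} [Fintype V] (G : SimpleGraph V) (c : Sym2 V → ℝ≥0)
    (T : SimpleGraph V) (A : Finset (V × ℝ≥0)) (S : V × ℝ≥0) : ℝ :=
  open Classical in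
  if gain G c T A S = 0 ∧ S.2 = 0 then 1 else gain G c T A S / (S.2 : ℝ)

/-- `I_A(S)`: the arcs of `Q̂(S)` whose undirected version is not in `Q(A)`. -/
noncomputable def newArcs {V : Type*} [Fintype V] (G : SimpleGraph V) (c : Sym2 V → ℝ≥0)
    (T : SimpleGraph V) (A : Finset (V × ℝ≥0)) (S : V × ℝ≥0) : Finset (V × V) :=
  open Classical in (Qhat G c T S).filter (fun a => s(a.1, a.2) ∉ QAll G c T A)

/-! ### The algorithm Greedy -/

/-- `GreedyReach G c T A M`: with the tree `T`, and with ties broken in some way, `A` and `M` are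
the values of the two variables of Greedy at one of the times when the loop condition
`f(A) < c(T)` is checked. -/
inductive GreedyReach {V : Type*} [Fintype V] (G : SimpleGraph V) (c : Sym2 V → ℝ≥0)
    (T : SimpleGraph V) : Finset (V × ℝ≥0) → Finset (V × V) → Prop
  | init : GreedyReach G c T ∅ (bidirected T)
  | step (A : Finset (V × ℝ≥0)) (M : Finset (V × V)) (S : V × ℝ≥0) :
      GreedyReach G c T A M →
      coverCost G c T A < treeCost c T →
      IsStar G c S →
      (∀ S', IsStar G c S' → ratio G c T A S' ≤ ratio G c T A S) →
      GreedyReach G c T (open Classical in insert S A)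
        (open Classical in M \ newArcs G c T A S)

/-- `H` is a possible output of Greedy (for some minimum spanning tree and some tie breaking). -/
def IsGreedyOutput {V : Type*} [Fintype V] (G : SimpleGraph V) (c : Sym2 V → ℝ≥0)
    (H : Finset (V × V)) : Prop :=
  ∃ T, IsMST G c T ∧ ∃ A M, GreedyReach G c T A M ∧ ¬ coverCost G c T A < treeCost c T ∧
    H = (open Classical in A.biUnion (starArcs G c) ∪ M)

/-- `1 + α + α ln (1 / α)`. -/
noncomputable def beta (α : ℝ) : ℝ := 1 + α + α * Real.log (1 / α)

/-! ### The machine model: while-programs on a random access machine with natural and real cells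

A program uses finitely many two-dimensional arrays of natural numbers and finitely many
two-dimensional arrays of real numbers; scalar variables are the cells with index `(0, 0)`.
Natural numbers can be added, subtracted and compared, and used as indices. Real numbers can be
added, subtracted and compared, and two products of two real numbers can be compared; there is no
multiplication, division, rounding or conversion between reals and naturals, and the only real
constant is zero. Hence, after `t` steps, every natural number has `O(t + log n)` bits and every
real number is a combination of the inputs with integer coefficients of `O(t)` bits, so that
for rational inputs a polynomial number of steps amounts to polynomial time on a Turing machine.
-/

/-- Expressions of type natural number (`sub` is truncated). -/
inductive NExp where
  | lit (k : ℕ)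
  | read (a : ℕ) (i j : NExp)
  | add (x y : NExp)
  | sub (x y : NExp)

/-- Expressions of type real number. -/
inductive RExp where
  | zero
  | read (a : ℕ) (i j : NExp)
  | add (x y : RExp)
  | sub (x y : RExp)

/-- Tests: `x ≤ y` for naturals and for reals, `x * y ≤ z * w` for reals, negation, conjunction. -/
inductive Test where
  | natLe (x y : NExp)
  | realLe (x y : RExp)
  | realMulLe (x y z w : RExp)
  | neg (b : Test)
  | conj (b b' : Test)

/-- Programs. -/
inductive Prog where
  | skip
  | natStore (a : ℕ) (i j : NExp) (e : NExp)
  | realStore (a : ℕ) (i j : NExp) (e : RExp)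
  | seq (P P' : Prog)
  | ite (b : Test) (P P' : Prog)
  | loop (b : Test) (P : Prog)

/-- Memory contents: the entry at `(i, j)` of the array number `a` of each of the two kinds. -/
structure Memory where
  nat : ℕ → ℕ → ℕ → ℕ
  real : ℕ → ℕ → ℕ → ℝ

def NExp.eval (m : Memory) : NExp → ℕ
  | lit k => k
  | read a i j => m.nat a (i.eval m) (j.eval m)
  | add x y => x.eval m + y.eval m
  | sub x y => x.eval m - y.eval m

noncomputable def RExp.eval (m : Memory) : RExp → ℝ
  | zero => 0
  | read a i j => m.real a (i.eval m) (j.eval m)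
  | add x y => x.eval m + y.eval m
  | sub x y => x.eval m - y.eval m

def Test.Holds (m : Memory) : Test → Prop
  | natLe x y => x.eval m ≤ y.eval m
  | realLe x y => x.eval m ≤ y.eval m
  | realMulLe x y z w => x.eval m * y.eval m ≤ z.eval m * w.eval m
  | neg b => ¬ b.Holds m
  | conj b b' => b.Holds m ∧ b'.Holds m

/-- Write `v` into the cell `(i, j)` of the array `a` of naturals. -/
def Memory.setNat (m : Memory) (a i j v : ℕ) : Memory where
  nat := fun a' i' j' => if a' = a ∧ i' = i ∧ j' = j then v else m.nat a' i' j'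
  real := m.real

/-- Write `v` into the cell `(i, j)` of the array `a` of reals. -/
noncomputable def Memory.setReal (m : Memory) (a i j : ℕ) (v : ℝ) : Memory where
  nat := m.nat
  real := fun a' i' j' => if a' = a ∧ i' = i ∧ j' = j then v else m.real a' i' j'

/-- `Exec P m t m'`: started in `m`, the program `P` halts in `m'` after `t` steps. Each store and
each evaluation of a test is a step (the expressions of a fixed program have bounded size, so that
charging every operation in them would change `t` by at most a constant factor). -/
inductive Exec : Prog → Memory → ℕ → Memory → Prop
  | skip (m : Memory) : Exec Prog.skip m 1 m
  | natStore (a : ℕ) (i j : NExp) (e : NExp) (m : Memory) :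
      Exec (Prog.natStore a i j e) m 1 (m.setNat a (i.eval m) (j.eval m) (e.eval m))
  | realStore (a : ℕ) (i j : NExp) (e : RExp) (m : Memory) :
      Exec (Prog.realStore a i j e) m 1 (m.setReal a (i.eval m) (j.eval m) (e.eval m))
  | seq {P P' : Prog} {m m' m'' : Memory} {t t' : ℕ} :
      Exec P m t m' → Exec P' m' t' m'' → Exec (Prog.seq P P') m (t + t') m''
  | iteTrue {b : Test} {P P' : Prog} {m m' : Memory} {t : ℕ} :
      b.Holds m → Exec P m t m' → Exec (Prog.ite b P P') m (t + 1) m'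
  | iteFalse {b : Test} {P P' : Prog} {m m' : Memory} {t : ℕ} :
      ¬ b.Holds m → Exec P' m t m' → Exec (Prog.ite b P P') m (t + 1) m'
  | loopFalse {b : Test} {P : Prog} {m : Memory} :
      ¬ b.Holds m → Exec (Prog.loop b P) m 1 m
  | loopTrue {b : Test} {P : Prog} {m m' m'' : Memory} {t t' : ℕ} :
      b.Holds m → Exec P m t m' → Exec (Prog.loop b P) m' t' m'' →
      Exec (Prog.loop b P) m (t + t' + 1) m''

/-- The initial memory for an input `(G, c)` with vertex set `{0, …, n - 1}`: the number `n` in the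
array 0 of naturals, the adjacency matrix in the array 1 of naturals, the costs of the edges in the
array 0 of reals, and zero everywhere else. -/
noncomputable def inputMemory {n : ℕ} (G : SimpleGraph (Fin n)) (c : Sym2 (Fin n) → ℝ≥0) :
    Memory where
  nat := fun a i j => open Classical in
    if a = 0 ∧ i = 0 ∧ j = 0 then n
    else if a = 1 ∧ ∃ (hi : i < n) (hj : j < n), G.Adj ⟨i, hi⟩ ⟨j, hj⟩ then 1
    else 0
  real := fun a i j => open Classical in
    if h : ∃ (hi : i < n) (hj : j < n), G.Adj ⟨i, hi⟩ ⟨j, hj⟩ then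
      if a = 0 then (c s(⟨i, h.1⟩, ⟨j, h.2.1⟩) : ℝ) else 0
    else 0

/-- The set of arcs that a final memory stands for: the array 2 of naturals is read as the
adjacency matrix of a directed graph on `{0, …, n - 1}`. -/
def outputArcs (n : ℕ) (m : Memory) : Finset (Fin n × Fin n) :=
  Finset.univ.filter (fun a => m.nat 2 a.1 a.2 ≠ 0)

end MinPower

/-!
# A 1.85-approximation for Min-Power Strong Connectivity

**Tree cuts.** All notions about paths of the spanning tree `T` are expressed by the relation
`Sep T e x y`: the edge `e` of `T` separates `x` from `y`. Then `Q(S)` consists of the edges that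
separate the centre of `S` from some vertex of `S`, and a chosen star removes from `M`, for each
newly covered edge, exactly the arc that points away from the centre.

**Feasibility** (`GreedyInv.step`). The ends of a covered edge reach each other using only arcs of
chosen stars and arcs of `M` over covered edges: the arc towards the centre of the star is kept, and
in the other direction one goes to the centre, uses an arc of the star, and comes back. Uncovered
edges keep both arcs.

**Ratio.** Let `H` be an optimal solution. The stars `S(v, p_H(v))` have total radius `opt`. As `H`
is strongly connected, it crosses each cut `T - e` in both directions, hence two of these stars cover
`e` (`two_le_card_covering`), and their total gain is at least twice the uncovered cost `y`. So the
star chosen by Greedy has ratio at least `2 y / opt`; it also has ratio at least `1`, because of the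
star that just reaches across an uncovered edge (`greedy_choice`). Integrating
`min (1, opt / (2 y))` over `0 ≤ y ≤ c(T)` bounds the total radius of the chosen stars
(`sum_radii_le`). The final `M` costs at most `c(T)`, since each edge has lost an arc, and
`c(T) ≤ opt` because a strongly connected digraph contains an in-arborescence
(`IsMST.treeCost_le_power`). With `K = opt / 2`, the sum is at most `2 c(T) ≤ opt` if `c(T) ≤ K`, and
otherwise `K + K ln (c(T) / K) + c(T) ≤ (3 / 2 + ln 2 / 2) opt`. The exchange property of minimum
spanning trees shows that stars of radius zero have gain zero, so that the ratio of a star with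
positive gain is never a division by zero.

**Program.** The program uses only counting loops up to `n`. Such programs (`SProg`) are total,
their effect is a function on memories, and their running time is bounded by a polynomial read off
from their text (`SProg.exists_exec`). Prim's algorithm builds the tree together with its parent
function and ancestor relation (`RootedTree`); the parent edge of `w` separates `x` from `y` if and
only if exactly one of them is in the subtree below `w`, so that `Q(S)`, gains and removed arcs are
computed directly. A star of maximum ratio is found among the stars with positive radius and
positive gain, since these include one of ratio at least `1` as long as an edge of positive cost is
uncovered.

Arrays of naturals used by the program: 0 the number `n`, 1 the adjacency matrix, 2 the output,
3 the vertices reached by Prim's algorithm, 4 the parents, 5 the ancestor relation, 6 the covered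
edges, 7 the set `M`, 8 the marks of the edges of one star; 10 to 14 loop counters, 15 to 17 the
result of a search. Arrays of reals: 0 the costs, 1 the gains.
-/

namespace MinPower

/-! ### Separation in trees, the sets `Q(S)` and the gain -/

section

variable {V : Type*}

/-- `e` separates `x` from `y` in `T`: they are in different components of `T - e`. If `T` is a tree,
this says that `e` lies on the path of `T` from `x` to `y`. -/
def Sep (T : SimpleGraph V) (e : Sym2 V) (x y : V) : Prop :=
  ¬ (T.deleteEdges {e}).Reachable x y

lemma Sep.cases {T : SimpleGraph V} {e : Sym2 V} {x y : V} (h : Sep T e x y) (u : V) :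
    Sep T e u x ∨ Sep T e u y := by
  by_contra hc
  simp only [Sep, not_or, not_not] at hc h
  exact h (hc.1.symm.trans hc.2)

lemma mem_edges_iff_sep {T : SimpleGraph V} (hT : T.IsAcyclic) {x y : V} {p : T.Walk x y}
    (hp : p.IsPath) (e : Sym2 V) : e ∈ p.edges ↔ Sep T e x y := by
  constructor
  · rintro he ⟨q⟩
    classical
    have hq := q.toPath.2
    have h1 := (hT.subsingleton_path x y).elim ⟨p, hp⟩
      ⟨(q.toPath : (T.deleteEdges {e}).Walk x y).mapLe (T.deleteEdges_le {e}), hq.mapLe _⟩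
    have h2 : p = _ := congrArg Subtype.val h1
    rw [h2, SimpleGraph.Walk.edges_mapLe_eq_edges] at he
    have := SimpleGraph.Walk.edges_subset_edgeSet _ he
    simp at this
  · intro h
    by_contra he
    exact h ⟨p.toDeleteEdge e he⟩

lemma sep_ends {T : SimpleGraph V} (hT : T.IsAcyclic) {a b : V} (h : T.Adj a b) :
    Sep T s(a, b) a b := by
  have := SimpleGraph.isAcyclic_iff_forall_adj_isBridge.1 hT h
  rwa [SimpleGraph.isBridge_iff] at this

lemma reachable_ends {T : SimpleGraph V} (hT : T.Connected) (a b x : V) :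
    (T.deleteEdges {s(a, b)}).Reachable x a ∨ (T.deleteEdges {s(a, b)}).Reachable x b := by
  obtain ⟨p⟩ := hT.preconnected x a
  induction p with
  | nil => exact Or.inl .rfl
  | @cons u v w h q ih =>
    by_cases he : s(u, v) = s(w, b)
    · rcases Sym2.eq_iff.1 he with ⟨rfl, -⟩ | ⟨rfl, -⟩
      · exact Or.inl .rfl
      · exact Or.inr .rfl
    · have h' : (T.deleteEdges {s(w, b)}).Adj u v := by
        simp [SimpleGraph.deleteEdges_adj, h, he]
      exact ih.imp h'.reachable.trans h'.reachable.trans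

lemma sep_mem_edgeSet {T : SimpleGraph V} (hT : T.Connected) {e : Sym2 V} {x y : V}
    (h : Sep T e x y) : e ∈ T.edgeSet := by
  by_contra he
  refine h ?_
  rw [SimpleGraph.deleteEdges_eq_self.2 (by simpa using he)]
  exact hT.preconnected x y

/-- On a path, the tail of a dart is on the same side of its edge as the start of the path. -/
lemma reachable_of_mem_darts {T : SimpleGraph V} {x y : V} (p : T.Walk x y)
    (hp : p.IsPath) {d : T.Dart} (hd : d ∈ p.darts) :
    (T.deleteEdges {d.edge}).Reachable x d.fst := by
  induction p with
  | nil => simp at hd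
  | @cons u v w h q ih =>
    rw [SimpleGraph.Walk.darts_cons, List.mem_cons] at hd
    rcases hd with rfl | hd
    · exact .rfl
    · have hne : s(u, v) ≠ d.edge := by
        intro he
        have := hp.isTrail.edges_nodup
        rw [SimpleGraph.Walk.edges_cons, List.nodup_cons] at this
        exact this.1 (he ▸ List.mem_map_of_mem hd)
      have h' : (T.deleteEdges {d.edge}).Adj u v := by
        simp [SimpleGraph.deleteEdges_adj, h, hne]
      exact h'.reachable.trans (ih hp.of_cons hd)

section fintype
variable [Fintype V] {G T : SimpleGraph V} {c : Sym2 V → ℝ≥0}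

lemma mem_bidirected {a b : V} : (a, b) ∈ bidirected G ↔ G.Adj a b := by
  simp [bidirected]

lemma mem_starArcs {S : V × ℝ≥0} {a b : V} :
    (a, b) ∈ starArcs G c S ↔ a = S.1 ∧ G.Adj a b ∧ c s(a, b) ≤ S.2 := by
  simp [starArcs]

lemma mem_starVerts {S : V × ℝ≥0} {x : V} :
    x ∈ starVerts G c S ↔ x = S.1 ∨ G.Adj S.1 x ∧ c s(S.1, x) ≤ S.2 := by
  simp [starVerts, mem_starArcs]

/-- Since a vertex is separated from one of any two separated vertices, the paths from the centre
suffice to describe `Q(S)`. -/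
lemma mem_QStar (hT : T.IsTree) {S : V × ℝ≥0} {e : Sym2 V} :
    e ∈ QStar G c T S ↔ ∃ x ∈ starVerts G c S, Sep T e S.1 x := by
  simp only [QStar, Finset.mem_filter, Finset.mem_univ, true_and]
  constructor
  · rintro ⟨x, hx, y, hy, p, hp, he⟩
    rcases ((mem_edges_iff_sep hT.isAcyclic hp e).1 he).cases S.1 with h | h
    exacts [⟨x, hx, h⟩, ⟨y, hy, h⟩]
  · rintro ⟨x, hx, h⟩
    obtain ⟨p, hp⟩ := (hT.connected.preconnected S.1 x).exists_isPath
    exact ⟨S.1, mem_starVerts.2 (.inl rfl), x, hx, p, hp, (mem_edges_iff_sep hT.isAcyclic hp e).2 h⟩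

/-- The arcs of `Q̂(S)` are those orientations of the edges of `Q(S)` whose tail is on the side of
the centre. -/
lemma mem_Qhat (hT : T.IsTree) {S : V × ℝ≥0} {a b : V} :
    (a, b) ∈ Qhat G c T S ↔ s(a, b) ∈ QStar G c T S ∧
      (T.deleteEdges {s(a, b)}).Reachable S.1 a := by
  rw [mem_QStar hT]
  simp only [Qhat, Finset.mem_filter, Finset.mem_univ, true_and]
  constructor
  · rintro ⟨x, hx, p, hp, d, hd, h⟩
    obtain rfl : d.fst = a := congrArg Prod.fst h
    obtain rfl : d.snd = b := congrArg Prod.snd h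
    refine ⟨⟨x, hx, ?_⟩, reachable_of_mem_darts p hp hd⟩
    rw [← mem_edges_iff_sep hT.isAcyclic hp]
    exact List.mem_map_of_mem (f := SimpleGraph.Dart.edge) hd
  · rintro ⟨⟨x, hx, hs⟩, hr⟩
    obtain ⟨p, hp⟩ := (hT.connected.preconnected S.1 x).exists_isPath
    have he := (mem_edges_iff_sep hT.isAcyclic hp _).2 hs
    obtain ⟨d, hd, hde⟩ := List.mem_map.1 he
    refine ⟨x, hx, p, hp, d, hd, ?_⟩
    rcases SimpleGraph.dart_edge_eq_mk'_iff.1 hde with h | h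
    · exact h
    · exfalso
      have h1 := reachable_of_mem_darts p hp hd
      rw [hde, show d.fst = b from congrArg Prod.fst h] at h1
      exact sep_ends hT.isAcyclic (sep_mem_edgeSet hT.connected hs) (hr.symm.trans h1)

lemma mem_QAll {A : Finset (V × ℝ≥0)} {e : Sym2 V} :
    e ∈ QAll G c T A ↔ ∃ S ∈ A, e ∈ QStar G c T S := by
  simp [QAll]

lemma mem_QAll_insert [DecidableEq (V × ℝ≥0)] {A : Finset (V × ℝ≥0)} {S : V × ℝ≥0}
    {e : Sym2 V} : e ∈ QAll G c T (insert S A) ↔ e ∈ QStar G c T S ∨ e ∈ QAll G c T A := by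
  simp [mem_QAll]

open Classical in
lemma QAll_insert (A : Finset (V × ℝ≥0)) (S : V × ℝ≥0) :
    QAll G c T (insert S A) = QStar G c T S ∪ QAll G c T A := by
  ext e; simp [mem_QAll_insert]

lemma mem_newArcs (hT : T.IsTree) {A : Finset (V × ℝ≥0)} {S : V × ℝ≥0} {a b : V} :
    (a, b) ∈ newArcs G c T A S ↔ s(a, b) ∈ QStar G c T S ∧ s(a, b) ∉ QAll G c T A ∧
      (T.deleteEdges {s(a, b)}).Reachable S.1 a := by
  simp only [newArcs, Finset.mem_filter, mem_Qhat hT]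
  tauto

lemma QStar_subset_edgeSet (hT : T.IsTree) {S : V × ℝ≥0} {e : Sym2 V} (h : e ∈ QStar G c T S) :
    e ∈ T.edgeSet := by
  obtain ⟨x, -, h⟩ := (mem_QStar hT).1 h
  exact sep_mem_edgeSet hT.connected h

open Classical in
/-- The set of edges as a `Finset`, with the instances that `treeCost` uses. -/
noncomputable def edges (T : SimpleGraph V) : Finset (Sym2 V) :=
  Finset.univ.filter (fun e => e ∈ T.edgeSet)

lemma mem_edges {e : Sym2 V} : e ∈ edges T ↔ e ∈ T.edgeSet := by simp [edges]

lemma treeCost_eq : treeCost c T = ∑ e ∈ edges T, c e := rfl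

lemma QAll_subset (hT : T.IsTree) (A : Finset (V × ℝ≥0)) : QAll G c T A ⊆ edges T := by
  intro e he
  obtain ⟨S, -, h⟩ := mem_QAll.1 he
  exact mem_edges.2 (QStar_subset_edgeSet hT h)

lemma coverCost_le (hT : T.IsTree) (A : Finset (V × ℝ≥0)) :
    coverCost G c T A ≤ treeCost c T :=
  Finset.sum_le_sum_of_subset (QAll_subset hT A)

open Classical in
lemma coverCost_insert (A : Finset (V × ℝ≥0)) (S : V × ℝ≥0) :
    coverCost G c T (insert S A) =
      ∑ e ∈ QStar G c T S \ QAll G c T A, c e + coverCost G c T A := by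
  rw [coverCost, QAll_insert, ← Finset.sdiff_union_self_eq_union,
    Finset.sum_union Finset.sdiff_disjoint, coverCost]

lemma coverCost_add_gain [DecidableEq (V × ℝ≥0)] (A : Finset (V × ℝ≥0)) (S : V × ℝ≥0) :
    (coverCost G c T A : ℝ) + gain G c T A S = coverCost G c T (insert S A) := by
  rw [gain, add_sub_cancel]
  congr!

open Classical in
lemma gain_eq (A : Finset (V × ℝ≥0)) (S : V × ℝ≥0) :
    gain G c T A S = ((∑ e ∈ QStar G c T S \ QAll G c T A, c e : ℝ≥0) : ℝ) := by
  have : gain G c T A S = (coverCost G c T (insert S A) : ℝ) - (coverCost G c T A : ℝ) := rfl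
  rw [this, coverCost_insert]; push_cast; ring

lemma gain_nonneg (A : Finset (V × ℝ≥0)) (S : V × ℝ≥0) : 0 ≤ gain G c T A S := by
  classical
  rw [gain_eq]; exact NNReal.coe_nonneg _

open Classical in
/-- Each newly covered edge loses exactly one of its two arcs. -/
lemma sum_newArcs (hT : T.IsTree) (A : Finset (V × ℝ≥0)) (S : V × ℝ≥0) :
    ∑ a ∈ newArcs G c T A S, c s(a.1, a.2) = ∑ e ∈ QStar G c T S \ QAll G c T A, c e := by
  refine Finset.sum_bij (fun a _ => s(a.1, a.2)) ?_ ?_ ?_ (fun _ _ => rfl)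
  · rintro ⟨a, b⟩ h
    obtain ⟨h1, h2, -⟩ := (mem_newArcs hT).1 h
    exact Finset.mem_sdiff.2 ⟨h1, h2⟩
  · rintro ⟨a, b⟩ h ⟨a', b'⟩ h' heq
    obtain ⟨h1, -, h2⟩ := (mem_newArcs hT).1 h
    obtain ⟨-, -, h3⟩ := (mem_newArcs hT).1 h'
    rcases Sym2.eq_iff.1 heq with ⟨rfl, rfl⟩ | ⟨rfl, rfl⟩
    · rfl
    · exfalso
      simp only at heq
      rw [← heq] at h3
      exact sep_ends hT.isAcyclic (QStar_subset_edgeSet hT h1) (h2.symm.trans h3)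
  · intro e he
    induction e with
    | h a b =>
      obtain ⟨h1, h2⟩ := Finset.mem_sdiff.1 he
      rcases reachable_ends hT.connected a b S.1 with h | h
      · exact ⟨(a, b), (mem_newArcs hT).2 ⟨h1, h2, h⟩, rfl⟩
      · refine ⟨(b, a), (mem_newArcs hT).2 ?_, Sym2.eq_swap⟩
        rw [Sym2.eq_swap]
        exact ⟨h1, h2, h⟩

open Classical in
lemma sum_bidirected_le (T : SimpleGraph V) :
    ∑ a ∈ bidirected T, c s(a.1, a.2) ≤ 2 * treeCost c T := by
  rw [treeCost_eq, ← Finset.sum_fiberwise_of_maps_to (t := edges T) (g := fun a => s(a.1, a.2)),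
    Finset.mul_sum]
  · refine Finset.sum_le_sum fun e _ => ?_
    induction e with
    | h x y =>
      calc ∑ a ∈ bidirected T with s(a.1, a.2) = s(x, y), c s(a.1, a.2)
          = ∑ a ∈ bidirected T with s(a.1, a.2) = s(x, y), c s(x, y) :=
            Finset.sum_congr rfl fun a ha => by rw [(Finset.mem_filter.1 ha).2]
        _ ≤ ∑ a ∈ {(x, y), (y, x)}, c s(x, y) := by
            refine Finset.sum_le_sum_of_subset ?_
            rintro ⟨a, b⟩ h
            simpa using (Finset.mem_filter.1 h).2
        _ ≤ 2 * c s(x, y) := by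
            rw [Finset.sum_const, nsmul_eq_mul]
            gcongr
            exact_mod_cast Finset.card_le_two
  · rintro ⟨a, b⟩ h
    exact mem_edges.2 (mem_bidirected.1 h)

end fintype

end

/-! ### Feasibility, power and minimum spanning trees -/

section

variable {V : Type*}

/-- `v` is reachable from `u` in the digraph with the arc set `H`. -/
def Reach (H : Set (V × V)) : V → V → Prop := Relation.ReflTransGen (fun x y => (x, y) ∈ H)

lemma Reach.mono {H H' : Set (V × V)} (h : H ⊆ H') {u v : V} (hr : Reach H u v) : Reach H' u v :=
  Relation.ReflTransGen.mono (r := fun x y => (x, y) ∈ H) (fun _ _ hx => h hx) _ _ hr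

lemma reach_of_mem_walk {T : SimpleGraph V} {H : Set (V × V)} {u v : V} (p : T.Walk u v)
    (hp : ∀ d ∈ p.darts, Reach H d.snd d.fst) : Reach H v u := by
  induction p with
  | nil => exact .refl
  | @cons u w v h q ih =>
    simp only [SimpleGraph.Walk.darts_cons, List.mem_cons, forall_eq_or_imp] at hp
    exact (ih hp.2).trans hp.1

/-- If all darts of a walk from `u` to `v` can be traversed backwards and `v` is reachable from
`u`, then the darts can also be traversed forwards. -/
lemma reach_dart {T : SimpleGraph V} {H : Set (V × V)} {u v : V} (p : T.Walk u v)
    (hp : ∀ d ∈ p.darts, Reach H d.snd d.fst) (huv : Reach H u v) :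
    ∀ d ∈ p.darts, Reach H d.fst d.snd := by
  induction p with
  | nil => simp
  | @cons u w v h q ih =>
    simp only [SimpleGraph.Walk.darts_cons, List.mem_cons, forall_eq_or_imp] at hp ⊢
    exact ⟨huv.trans (reach_of_mem_walk q hp.2), ih hp.2 (hp.1.trans huv)⟩

/-- An arc leaves every set that contains `u` but not `v`. -/
lemma StronglyConnected.exists_crossing {H : Finset (V × V)} (h : StronglyConnected H)
    (X : V → Prop) {u v : V} (hu : X u) (hv : ¬ X v) : ∃ a b, (a, b) ∈ H ∧ X a ∧ ¬ X b := by
  by_contra! hc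
  refine hv ?_
  have := h u v
  induction this with
  | refl => exact hu
  | tail _ hbc ih => exact hc _ _ hbc (by_contra fun hn => hn (by_contra fun h' => h' (ih h')))


lemma le_vertexPower {c : Sym2 V → ℝ≥0} {H : Finset (V × V)} {u v : V} (h : (u, v) ∈ H) :
    c s(u, v) ≤ vertexPower c H u := by
  classical
  have := Finset.le_sup (f := fun a : V × V => c s(a.1, a.2))
    (Finset.mem_filter.2 ⟨h, rfl⟩ : (u, v) ∈ H.filter (fun a => a.1 = u))
  rw [vertexPower]
  convert this

lemma exists_vertexPower_eq {c : Sym2 V → ℝ≥0} {H : Finset (V × V)} {u v : V} (h : (u, v) ∈ H) :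
    ∃ w, (u, w) ∈ H ∧ c s(u, w) = vertexPower c H u := by
  classical
  obtain ⟨⟨a, w⟩, ha, he⟩ := Finset.exists_mem_eq_sup (H.filter (fun a => a.1 = u))
    ⟨(u, v), Finset.mem_filter.2 ⟨h, rfl⟩⟩ (fun a : V × V => c s(a.1, a.2))
  obtain ⟨ha', rfl⟩ := Finset.mem_filter.1 ha
  refine ⟨w, ha', ?_⟩
  rw [vertexPower]
  convert he.symm


open Classical in
lemma vertexPower_union_le {c : Sym2 V → ℝ≥0} (H H' : Finset (V × V)) (u : V) :
    vertexPower c (H ∪ H') u ≤ vertexPower c H u + vertexPower c H' u := by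
  refine Finset.sup_le fun ⟨a, b⟩ hab => ?_
  obtain ⟨hab', rfl⟩ := Finset.mem_filter.1 hab
  rcases Finset.mem_union.1 hab' with h | h
  · exact (le_vertexPower h).trans le_self_add
  · exact (le_vertexPower h).trans le_add_self

section fintype
variable [Fintype V] {G T : SimpleGraph V} {c : Sym2 V → ℝ≥0}

/-- The arcs of the stars in `A`, and the arcs of `M` whose edge is covered by `A`. -/
def coveredArcs (G : SimpleGraph V) (c : Sym2 V → ℝ≥0) (T : SimpleGraph V)
    (A : Finset (V × ℝ≥0)) (M : Finset (V × V)) : Set (V × V) :=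
  {a | (∃ S ∈ A, a ∈ starArcs G c S) ∨ (a ∈ M ∧ s(a.1, a.2) ∈ QAll G c T A)}

/-- The invariant of Greedy behind the feasibility of its output: uncovered edges of `T` have both
arcs in `M`, while the ends of a covered edge reach each other through `coveredArcs` alone. The
latter restriction is what makes the invariant inductive, since the arcs that are removed from `M`
later on belong to edges that are not covered yet. -/
structure GreedyInv (G : SimpleGraph V) (c : Sym2 V → ℝ≥0) (T : SimpleGraph V)
    (A : Finset (V × ℝ≥0)) (M : Finset (V × V)) : Prop where
  subset : M ⊆ bidirected T
  mem_of_notMem : ∀ x y, T.Adj x y → s(x, y) ∉ QAll G c T A → (x, y) ∈ M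
  reach : ∀ x y, T.Adj x y → s(x, y) ∈ QAll G c T A → Reach (coveredArcs G c T A M) x y
  cost : ∑ a ∈ M, c s(a.1, a.2) + coverCost G c T A ≤ 2 * treeCost c T

open Classical in
/-- If `ab` becomes covered by the star `S` and `a` is on the side of its centre, then `b` still
reaches `a` directly, while `a` reaches `b` along the tree to the centre, by an arc of the star to a
vertex beyond `b`, and back along the tree. -/
lemma GreedyInv.step (hT : T.IsTree) {A : Finset (V × ℝ≥0)} {M : Finset (V × V)}
    (h : GreedyInv G c T A M) (S : V × ℝ≥0) :
    GreedyInv G c T (insert S A) (M \ newArcs G c T A S) := by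
  have hnew : newArcs G c T A S ⊆ M := by
    rintro ⟨a, b⟩ hab
    obtain ⟨h1, h2, -⟩ := (mem_newArcs hT).1 hab
    exact h.mem_of_notMem a b (QStar_subset_edgeSet hT h1) h2
  have hmono : coveredArcs G c T A M ⊆
      coveredArcs G c T (insert S A) (M \ newArcs G c T A S) := by
    rintro ⟨a, b⟩ (⟨S', hS', ha⟩ | ⟨ha, hq⟩)
    · exact .inl ⟨S', Finset.mem_insert_of_mem hS', ha⟩
    · refine .inr ⟨Finset.mem_sdiff.2 ⟨ha, fun hn => ((mem_newArcs hT).1 hn).2.1 hq⟩, ?_⟩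
      rw [QAll_insert]
      exact Finset.mem_union_right _ hq
  refine ⟨Finset.sdiff_subset.trans h.subset, ?_, ?_, ?_⟩
  · intro x y hxy hn
    rw [QAll_insert, Finset.mem_union, not_or] at hn
    exact Finset.mem_sdiff.2 ⟨h.mem_of_notMem x y hxy hn.2,
      fun hm => hn.1 ((mem_newArcs hT).1 hm).1⟩
  · intro x y hxy he
    by_cases hA : s(x, y) ∈ QAll G c T A
    · exact (h.reach x y hxy hA).mono hmono
    have hQ : s(x, y) ∈ QStar G c T S := by
      rw [QAll_insert, Finset.mem_union] at he
      exact he.resolve_right hA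
    obtain ⟨v, hv, hsep⟩ := (mem_QStar hT).1 hQ
    obtain ⟨p, hp⟩ := (hT.connected.preconnected S.1 v).exists_isPath
    have hdart : ∀ d ∈ p.darts,
        Reach (coveredArcs G c T (insert S A) (M \ newArcs G c T A S)) d.snd d.fst := by
      intro d hd
      have hdS : d.edge ∈ QStar G c T S := (mem_QStar hT).2 ⟨v, hv,
        (mem_edges_iff_sep hT.isAcyclic hp _).1 (List.mem_map_of_mem hd)⟩
      have hde : d.edge = s(d.snd, d.fst) := by
        rw [Sym2.eq_swap]; rfl
      have hr := reachable_of_mem_darts p hp hd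
      rw [hde] at hdS hr
      by_cases hdA : s(d.snd, d.fst) ∈ QAll G c T A
      · exact (h.reach _ _ d.adj.symm hdA).mono hmono
      · refine .single (.inr ⟨Finset.mem_sdiff.2 ⟨h.mem_of_notMem _ _ d.adj.symm hdA, ?_⟩, ?_⟩)
        · intro hm
          exact sep_ends hT.isAcyclic d.adj.symm (((mem_newArcs hT).1 hm).2.2.symm.trans hr)
        · rw [QAll_insert]
          exact Finset.mem_union_left _ hdS
    have huv : Reach (coveredArcs G c T (insert S A) (M \ newArcs G c T A S)) S.1 v := by
      rcases mem_starVerts.1 hv with rfl | hv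
      · exact .refl
      · exact .single (.inl ⟨S, Finset.mem_insert_self _ _, mem_starArcs.2 ⟨rfl, hv⟩⟩)
    obtain ⟨d, hd, hde⟩ := List.mem_map.1 ((mem_edges_iff_sep hT.isAcyclic hp _).2 hsep)
    rcases SimpleGraph.dart_edge_eq_mk'_iff.1 hde with h' | h'
    · have := reach_dart p hdart huv d hd
      rwa [show d.fst = x from congrArg Prod.fst h',
        show d.snd = y from congrArg Prod.snd h'] at this
    · have := hdart d hd
      rwa [show d.fst = y from congrArg Prod.fst h',
        show d.snd = x from congrArg Prod.snd h'] at this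
  · rw [coverCost_insert, ← sum_newArcs hT, ← add_assoc, Finset.sum_sdiff hnew]
    exact h.cost

lemma greedyInv (hT : T.IsTree) {A : Finset (V × ℝ≥0)} {M : Finset (V × V)}
    (h : GreedyReach G c T A M) : GreedyInv G c T A M := by
  induction h with
  | init =>
    refine ⟨subset_rfl, fun x y hxy _ => mem_bidirected.2 hxy, ?_, ?_⟩
    · intro x y _ h
      simp [mem_QAll] at h
    · have : coverCost G c T ∅ = 0 := by simp [coverCost, QAll]
      rw [this, add_zero]
      exact sum_bidirected_le T
  | step A M S _ _ _ _ ih => exact ih.step hT S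

open Classical in
lemma GreedyInv.isSolution (hTG : T ≤ G) (hT : T.IsTree) {A : Finset (V × ℝ≥0)}
    {M : Finset (V × V)} (h : GreedyInv G c T A M) :
    IsSolution G (A.biUnion (starArcs G c) ∪ M) := by
  constructor
  · rintro ⟨a, b⟩ hab
    rw [mem_bidirected]
    rcases Finset.mem_union.1 hab with hab | hab
    · obtain ⟨S, -, hab⟩ := Finset.mem_biUnion.1 hab
      exact (mem_starArcs.1 hab).2.1
    · exact hTG (mem_bidirected.1 (h.subset hab))
  · intro u v
    obtain ⟨p⟩ := hT.connected.preconnected v u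
    refine reach_of_mem_walk (H := ((A.biUnion (starArcs G c) ∪ M : Finset (V × V)) : Set (V × V)))
      p fun d _ => ?_
    by_cases hd : s(d.snd, d.fst) ∈ QAll G c T A
    · refine (h.reach _ _ d.adj.symm hd).mono ?_
      rintro ⟨a, b⟩ (⟨S, hS, ha⟩ | ⟨ha, -⟩)
      · exact Finset.mem_union_left _ (Finset.mem_biUnion.2 ⟨S, hS, ha⟩)
      · exact Finset.mem_union_right _ ha
    · exact .single (Finset.mem_union_right _ (h.mem_of_notMem _ _ d.adj.symm hd))

lemma vertexPower_le_sum (M : Finset (V × V)) (u : V) :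
    vertexPower c M u ≤ ∑ b, (open Classical in if (u, b) ∈ M then c s(u, b) else 0) := by
  classical
  refine Finset.sup_le fun ⟨a, b⟩ hab => ?_
  obtain ⟨hab', rfl⟩ := Finset.mem_filter.1 hab
  have := Finset.single_le_sum (f := fun b' => if (a, b') ∈ M then c s(a, b') else 0)
    (fun _ _ => zero_le) (Finset.mem_univ b)
  simpa [show (a, b) ∈ M from hab'] using this

open Classical in
lemma power_le_sum (M : Finset (V × V)) : power c M ≤ ∑ a ∈ M, c s(a.1, a.2) := by
  refine (Finset.sum_le_sum fun u _ => vertexPower_le_sum M u).trans_eq ?_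
  rw [← Finset.sum_product', ← Finset.sum_filter]
  exact Finset.sum_congr (by ext; simp) fun _ _ => rfl

open Classical in
lemma power_stars_le (A : Finset (V × ℝ≥0)) :
    power c (A.biUnion (starArcs G c)) ≤ ∑ S ∈ A, S.2 := by
  induction A using Finset.induction_on with
  | empty => simp [power, vertexPower]
  | insert S A hS ih =>
    rw [Finset.sum_insert hS, Finset.biUnion_insert]
    refine (Finset.sum_le_sum fun u _ => vertexPower_union_le _ _ u).trans ?_
    rw [Finset.sum_add_distrib]
    refine add_le_add ?_ ih
    calc ∑ u, vertexPower c (starArcs G c S) u ≤ ∑ u, if u = S.1 then S.2 else 0 := by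
          refine Finset.sum_le_sum fun u _ => Finset.sup_le fun ⟨a, b⟩ hab => ?_
          obtain ⟨hab', rfl⟩ := Finset.mem_filter.1 hab
          obtain ⟨h1, -, h2⟩ := mem_starArcs.1 hab'
          simpa [h1] using h2
      _ = S.2 := by simp

open Classical in
lemma power_union_le (H H' : Finset (V × V)) : power c (H ∪ H') ≤ power c H + power c H' := by
  rw [power, power, power, ← Finset.sum_add_distrib]
  exact Finset.sum_le_sum fun u _ => vertexPower_union_le H H' u

lemma exists_isOpt (hG : G.Connected) : ∃ x, IsOpt G c x := by
  classical
  have hne : {y | ∃ H, IsSolution G H ∧ power c H = y}.Nonempty := by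
    refine ⟨_, bidirected G, ⟨subset_rfl, fun u v => ?_⟩, rfl⟩
    obtain ⟨p⟩ := hG.preconnected v u
    refine reach_of_mem_walk (H := (bidirected G : Set (V × V))) p fun d _ => ?_
    exact .single (mem_bidirected.2 d.adj.symm)
  have hfin : {y | ∃ H, IsSolution G H ∧ power c H = y}.Finite :=
    (Set.finite_range (power c)).subset (by rintro _ ⟨H, -, rfl⟩; exact ⟨H, rfl⟩)
  obtain ⟨x, hx, hmin⟩ := hfin.exists_minimal hne
  exact ⟨x, hx, fun y hy => (le_total x y).elim id fun h => hmin hy h⟩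

/-- A strongly connected digraph contains, for every root, an in-arborescence. -/
lemma exists_arborescence {H : Finset (V × V)} (h : StronglyConnected H) (r : V) :
    ∃ nxt : V → V, (∀ v ≠ r, (v, nxt v) ∈ H) ∧
      (SimpleGraph.fromEdgeSet {e | ∃ v ≠ r, e = s(v, nxt v)}).Connected := by
  classical
  -- grow the set `X` of the vertices that are joined to the root, by an arc that enters `X`
  have key : ∀ k ≤ Fintype.card V, ∃ (X : Finset V) (nxt : V → V), r ∈ X ∧ k ≤ X.card ∧
      (∀ v ∈ X, v ≠ r → (v, nxt v) ∈ H) ∧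
      ∀ v ∈ X, (SimpleGraph.fromEdgeSet {e | ∃ v ∈ X, v ≠ r ∧ e = s(v, nxt v)}).Reachable v r := by
    intro k
    induction k with
    | zero => exact fun _ => ⟨{r}, id, by simp, by simp, by simp, by simp⟩
    | succ k ih =>
      intro hk
      obtain ⟨X, nxt, hr, hkX, hn, hreach⟩ := ih (by omega)
      by_cases hX : k + 1 ≤ X.card
      · exact ⟨X, nxt, hr, hX, hn, hreach⟩
      obtain ⟨v, hv⟩ : ∃ v, v ∉ X := by
        by_contra! hall
        have := Finset.card_le_card (fun x _ => hall x : (Finset.univ : Finset V) ⊆ X)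
        rw [Finset.card_univ] at this
        omega
      obtain ⟨a, b, hab, ha, hb⟩ := h.exists_crossing (fun x => x ∉ X) hv (v := r) (by simpa)
      simp only [not_not] at hb
      have hnxt : ∀ v ∈ X, Function.update nxt a b v = nxt v := fun v hv =>
        Function.update_of_ne (by rintro rfl; exact ha hv) _ _
      have hle : SimpleGraph.fromEdgeSet {e | ∃ v ∈ X, v ≠ r ∧ e = s(v, nxt v)} ≤
          SimpleGraph.fromEdgeSet {e | ∃ v ∈ insert a X, v ≠ r ∧
            e = s(v, Function.update nxt a b v)} := by
        refine SimpleGraph.fromEdgeSet_mono ?_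
        rintro e ⟨v, hv, hvr, rfl⟩
        exact ⟨v, Finset.mem_insert_of_mem hv, hvr, by rw [hnxt v hv]⟩
      have har : a ≠ r := fun h => ha (h ▸ hr)
      refine ⟨insert a X, Function.update nxt a b, Finset.mem_insert_of_mem hr, ?_, ?_, ?_⟩
      · rw [Finset.card_insert_of_notMem ha]; omega
      · intro v hv hvr
        rcases Finset.mem_insert.1 hv with rfl | hv
        · simpa using hab
        · rw [hnxt v hv]; exact hn v hv hvr
      · intro v hv
        rcases Finset.mem_insert.1 hv with rfl | hv
        · refine SimpleGraph.Reachable.trans (SimpleGraph.Adj.reachable ?_) ((hreach b hb).mono hle)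
          rw [SimpleGraph.fromEdgeSet_adj]
          exact ⟨⟨v, Finset.mem_insert_self _ _, har, by simp⟩, fun h => ha (by rwa [h])⟩
        · exact (hreach v hv).mono hle
  obtain ⟨X, nxt, -, hk, hn, hreach⟩ := key _ le_rfl
  have hX : X = Finset.univ := Finset.eq_univ_of_card _ (le_antisymm (Finset.card_le_univ _) hk)
  subst hX
  simp only [Finset.mem_univ, true_and, true_implies] at hn hreach
  have : Nonempty V := ⟨r⟩
  exact ⟨nxt, hn, SimpleGraph.Connected.mk fun u v => (hreach u).trans (hreach v).symm⟩

/-- A minimum spanning tree costs at most the power of any feasible solution. -/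
lemma IsMST.treeCost_le_power (hT : IsMST G c T) {H : Finset (V × V)} (hH : IsSolution G H) :
    treeCost c T ≤ power c H := by
  classical
  obtain ⟨r⟩ := hT.1.2.connected.nonempty
  obtain ⟨nxt, hn, hc⟩ := exists_arborescence hH.2 r
  obtain ⟨T', hT', htree⟩ := hc.exists_isTree_le
  have hle : T' ≤ G := by
    intro x y hxy
    obtain ⟨⟨v, hv, he⟩, -⟩ := (SimpleGraph.fromEdgeSet_adj _).1 (hT' hxy)
    have : G.Adj v (nxt v) := mem_bidirected.1 (hH.1 (hn v hv))
    rw [← SimpleGraph.mem_edgeSet, he]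
    exact this
  refine (hT.2 T' ⟨hle, htree⟩).trans ?_
  rw [treeCost_eq]
  have hsub : edges T' ⊆ (Finset.univ.erase r).image (fun v => s(v, nxt v)) := by
    intro e he
    have he := SimpleGraph.edgeSet_mono hT' (mem_edges.1 he)
    rw [SimpleGraph.edgeSet_fromEdgeSet] at he
    obtain ⟨v, hv, rfl⟩ := he.1
    exact Finset.mem_image.2 ⟨v, by simpa using hv, rfl⟩
  calc ∑ e ∈ edges T', c e ≤ ∑ e ∈ (Finset.univ.erase r).image (fun v => s(v, nxt v)), c e :=
        Finset.sum_le_sum_of_subset hsub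
    _ ≤ ∑ v ∈ Finset.univ.erase r, c s(v, nxt v) :=
        Finset.sum_image_le_of_nonneg fun _ _ => zero_le
    _ ≤ ∑ v ∈ Finset.univ.erase r, vertexPower c H v :=
        Finset.sum_le_sum fun v hv => le_vertexPower (hn v (Finset.ne_of_mem_erase hv))
    _ ≤ power c H := Finset.sum_le_sum_of_subset (Finset.erase_subset _ _)

/-- Exchanging a tree edge for another edge that joins the same two sides. -/
lemma IsSpanningTree.exchange (hT : IsSpanningTree G T) {a b x y : V}
    (hs : Sep T s(a, b) x y) (hxy : G.Adj x y) :
    IsSpanningTree G (T.deleteEdges {s(a, b)} ⊔ SimpleGraph.edge x y) ∧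
      treeCost c (T.deleteEdges {s(a, b)} ⊔ SimpleGraph.edge x y) + c s(a, b) =
        treeCost c T + c s(x, y) := by
  classical
  have hne := hxy.ne
  have hadj : (T.deleteEdges {s(a, b)} ⊔ SimpleGraph.edge x y).Adj x y := by
    simp [SimpleGraph.edge_adj, hne]
  have hle : T.deleteEdges {s(a, b)} ≤ T.deleteEdges {s(a, b)} ⊔ SimpleGraph.edge x y :=
    le_sup_left
  have := hT.2.connected.nonempty
  refine ⟨⟨sup_le ((T.deleteEdges_le _).trans hT.1) ?_, ?_, ?_⟩, ?_⟩
  · exact (SimpleGraph.edge_le_iff G).2 (.inr hxy)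
  · have hxr : ∀ v, (T.deleteEdges {s(a, b)}).Reachable v x ∨
        (T.deleteEdges {s(a, b)}).Reachable v y := by
      intro v
      by_contra hc
      rw [not_or] at hc
      rcases reachable_ends hT.2.connected a b v with h | h <;>
      rcases reachable_ends hT.2.connected a b x with h' | h' <;>
      rcases reachable_ends hT.2.connected a b y with h'' | h'' <;>
      first
        | exact hc.1 (h.trans h'.symm)
        | exact hc.2 (h.trans h''.symm)
        | exact hs (h'.trans h''.symm)
    have hall : ∀ v, (T.deleteEdges {s(a, b)} ⊔ SimpleGraph.edge x y).Reachable v x := fun v =>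
      (hxr v).elim (fun h => h.mono hle) fun h => (h.mono hle).trans hadj.reachable.symm
    exact SimpleGraph.Connected.mk fun u v => (hall u).trans (hall v).symm
  · exact (hT.2.isAcyclic.anti (T.deleteEdges_le _)).sup_edge_of_not_reachable hs
  · have hab := mem_edges.2 (sep_mem_edgeSet hT.2.connected hs)
    have hxy' : s(x, y) ∉ (edges T).erase s(a, b) := by
      intro h
      refine hs (SimpleGraph.Adj.reachable ?_)
      rw [Finset.mem_erase, mem_edges, SimpleGraph.mem_edgeSet] at h
      exact (SimpleGraph.deleteEdges_adj ..).2 ⟨h.2, h.1⟩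
    have : edges (T.deleteEdges {s(a, b)} ⊔ SimpleGraph.edge x y) =
        insert s(x, y) ((edges T).erase s(a, b)) := by
      ext e
      simp only [mem_edges, SimpleGraph.edgeSet_sup, SimpleGraph.edgeSet_deleteEdges,
        SimpleGraph.edgeSet_edge_of_ne hne, Finset.mem_insert, Finset.mem_erase]
      simp only [Set.mem_union, Set.mem_sdiff, Set.mem_singleton_iff]
      tauto
    rw [treeCost_eq, treeCost_eq, this, Finset.sum_insert hxy', add_assoc,
      Finset.sum_erase_add _ _ hab, add_comm]

/-- The bottleneck property: a minimum spanning tree joins `x` and `y` by edges not more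
expensive than `xy`. -/
lemma IsMST.cost_le_of_sep (hT : IsMST G c T) {e : Sym2 V} {x y : V} (hs : Sep T e x y)
    (hxy : G.Adj x y) : c e ≤ c s(x, y) := by
  induction e with
  | h a b =>
    obtain ⟨h1, h2⟩ := hT.1.exchange (c := c) hs hxy
    have h3 := hT.2 _ h1
    refine le_of_add_le_add_left (a := treeCost c T) ?_
    rw [← h2]
    gcongr

lemma IsMST.gain_eq_zero (hT : IsMST G c T) (A : Finset (V × ℝ≥0)) {S : V × ℝ≥0}
    (hS : S.2 = 0) : gain G c T A S = 0 := by
  classical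
  rw [gain_eq, Finset.sum_eq_zero, NNReal.coe_zero]
  intro e he
  obtain ⟨x, hx, hs⟩ := (mem_QStar hT.1.2).1 (Finset.mem_sdiff.1 he).1
  rcases mem_starVerts.1 hx with rfl | ⟨hx, hc⟩
  · exact absurd .rfl hs
  · exact le_antisymm ((hT.cost_le_of_sep hs hx).trans (hc.trans_eq hS)) zero_le

end fintype

end

/-! ### The greedy choice and the approximation ratio -/

section

variable {V : Type*} [Fintype V] {G T : SimpleGraph V} {c : Sym2 V → ℝ≥0}

lemma exists_uncovered {A : Finset (V × ℝ≥0)} (h : coverCost G c T A < treeCost c T) :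
    ∃ x y, T.Adj x y ∧ s(x, y) ∉ QAll G c T A ∧ 0 < c s(x, y) := by
  by_contra! hc
  refine h.not_ge (Finset.sum_le_sum_of_ne_zero fun e he h0 => ?_)
  induction e with
  | h x y =>
    by_contra hA
    exact h0 (le_antisymm (hc x y (mem_edges.1 he) hA) zero_le)

/-- The star with centre `x` that just reaches `y` covers the tree edge `xy`. -/
lemma cost_le_gain (hT : IsSpanningTree G T) {A : Finset (V × ℝ≥0)} {x y : V} (hxy : T.Adj x y)
    (hA : s(x, y) ∉ QAll G c T A) : (c s(x, y) : ℝ) ≤ gain G c T A (x, c s(x, y)) := by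
  classical
  rw [gain_eq, NNReal.coe_le_coe]
  refine Finset.single_le_sum (f := c) (fun _ _ => zero_le) (Finset.mem_sdiff.2 ⟨?_, hA⟩)
  rw [mem_QStar hT.2]
  exact ⟨y, mem_starVerts.2 (.inr ⟨hT.1 hxy, le_rfl⟩), sep_ends hT.2.isAcyclic hxy⟩

lemma exists_one_le_ratio (hT : IsSpanningTree G T) {A : Finset (V × ℝ≥0)}
    (h : coverCost G c T A < treeCost c T) :
    ∃ S, IsStar G c S ∧ 0 < S.2 ∧ (S.2 : ℝ) ≤ gain G c T A S := by
  obtain ⟨x, y, hxy, hA, hpos⟩ := exists_uncovered h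
  exact ⟨(x, c s(x, y)), ⟨y, hT.1 hxy, rfl⟩, hpos, cost_le_gain hT hxy hA⟩

lemma ratio_of_pos {A : Finset (V × ℝ≥0)} {S : V × ℝ≥0} (h : 0 < S.2) :
    ratio G c T A S = gain G c T A S / S.2 := by
  classical
  exact if_neg fun h' => h.ne' h'.2

lemma ratio_le_one {A : Finset (V × ℝ≥0)} {S : V × ℝ≥0} (h : S.2 = 0) :
    ratio G c T A S ≤ 1 := by
  unfold ratio
  split_ifs
  · exact le_rfl
  · simp [h]

lemma star_covers {H : Finset (V × V)} (hH : IsSolution G H) (hT : T.IsTree) {a b x y : V}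
    (hxy : (x, y) ∈ H) (hs : Sep T s(a, b) x y) :
    s(a, b) ∈ QStar G c T (x, vertexPower c H x) :=
  (mem_QStar hT).2 ⟨y, mem_starVerts.2 (.inr ⟨mem_bidirected.1 (hH.1 hxy), le_vertexPower hxy⟩), hs⟩

/-- Every edge of the tree is crossed in both directions by a feasible solution, hence is covered
by at least two of the stars that the solution consists of. -/
lemma two_le_card_covering {H : Finset (V × V)} (hH : IsSolution G H) (hT : T.IsTree)
    {e : Sym2 V} (he : e ∈ T.edgeSet) :
    2 ≤ (open Classical in
      Finset.univ.filter (fun v => e ∈ QStar G c T (v, vertexPower c H v))).card := by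
  classical
  induction e with
  | h a b =>
    have hab := sep_ends hT.isAcyclic he
    obtain ⟨x, y, hxy, hx, hy⟩ := hH.2.exists_crossing
      (fun x => (T.deleteEdges {s(a, b)}).Reachable a x) .rfl hab
    obtain ⟨z, w, hzw, hz, hw⟩ := hH.2.exists_crossing
      (fun x => ¬ (T.deleteEdges {s(a, b)}).Reachable a x) hab (v := a) (not_not.2 .rfl)
    rw [not_not] at hw
    have h1 := star_covers (c := c) hH hT (a := a) (b := b) hxy fun h => hy (hx.trans h)
    have h2 := star_covers (c := c) hH hT (a := a) (b := b) hzw fun h => hz (hw.trans h.symm)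
    have hne : x ≠ z := by rintro rfl; exact hz hx
    rw [← Finset.card_pair hne]
    refine Finset.card_le_card fun v hv => ?_
    rcases Finset.mem_insert.1 hv with rfl | hv
    · simpa using h1
    · rw [Finset.mem_singleton.1 hv]; simpa using h2

/-- The stars that a feasible solution consists of have a total gain of at least twice the cost of
the uncovered edges. -/
lemma two_mul_le_sum_gain {H : Finset (V × V)} (hH : IsSolution G H) (hT : T.IsTree)
    (A : Finset (V × ℝ≥0)) :
    2 * ((treeCost c T : ℝ) - coverCost G c T A) ≤
      ∑ v, gain G c T A (v, vertexPower c H v) := by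
  classical
  have h1 : (treeCost c T : ℝ) - coverCost G c T A =
      ((∑ e ∈ edges T \ QAll G c T A, c e : ℝ≥0) : ℝ) := by
    rw [sub_eq_iff_eq_add, ← NNReal.coe_add, coverCost, Finset.sum_sdiff (QAll_subset hT A),
      treeCost_eq]
  simp_rw [h1, gain_eq]
  rw [← NNReal.coe_sum]
  norm_cast
  calc 2 * ∑ e ∈ edges T \ QAll G c T A, c e
      ≤ ∑ e ∈ edges T \ QAll G c T A, ∑ v, if e ∈ QStar G c T (v, vertexPower c H v)
          then c e else 0 := by
        rw [Finset.mul_sum]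
        refine Finset.sum_le_sum fun e he => ?_
        rw [← Finset.sum_filter, Finset.sum_const, nsmul_eq_mul]
        gcongr
        exact_mod_cast two_le_card_covering hH hT (mem_edges.1 (Finset.mem_sdiff.1 he).1)
    _ = ∑ v, ∑ e ∈ QStar G c T (v, vertexPower c H v) \ QAll G c T A, c e := by
        rw [Finset.sum_comm]
        refine Finset.sum_congr rfl fun v _ => ?_
        rw [← Finset.sum_filter]
        refine Finset.sum_congr ?_ fun _ _ => rfl
        ext e
        simp only [Finset.mem_filter, Finset.mem_sdiff, mem_edges]
        exact ⟨fun h => ⟨h.2, h.1.2⟩, fun h => ⟨⟨QStar_subset_edgeSet hT h.1, h.2⟩, h.1⟩⟩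

/-- A star `S(u, r)` of maximum ratio satisfies `r ≤ g` and `2 y r ≤ g p(H)`, where `g` is its gain,
`y` is the cost of the uncovered edges and `H` is any feasible solution. -/
lemma greedy_choice (hT : IsMST G c T) {H : Finset (V × V)} (hH : IsSolution G H)
    {A : Finset (V × ℝ≥0)} (hA : coverCost G c T A < treeCost c T) {S : V × ℝ≥0}
    (hmax : ∀ S', IsStar G c S' → ratio G c T A S' ≤ ratio G c T A S) :
    (S.2 : ℝ) ≤ gain G c T A S ∧
      2 * ((treeCost c T : ℝ) - coverCost G c T A) * S.2 ≤ gain G c T A S * power c H := by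
  rcases eq_or_ne S.2 0 with h0 | h0
  · have := gain_nonneg (G := G) (c := c) (T := T) A S
    simp only [h0, NNReal.coe_zero, mul_zero]
    exact ⟨this, by positivity⟩
  have hpos : 0 < S.2 := pos_iff_ne_zero.2 h0
  have hpos' : (0 : ℝ) < S.2 := hpos
  rw [ratio_of_pos hpos] at hmax
  have hle : ∀ S', IsStar G c S' → gain G c T A S' * S.2 ≤ gain G c T A S * S'.2 := by
    intro S' hS'
    rcases eq_or_ne S'.2 0 with h | h
    · -- here the ratio would be a division by zero
      rw [hT.gain_eq_zero A h, h]; simp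
    · have hp : 0 < S'.2 := pos_iff_ne_zero.2 h
      have hp' : (0 : ℝ) < S'.2 := hp
      have := hmax S' hS'
      rwa [ratio_of_pos hp, div_le_div_iff₀ hp' hpos'] at this
  constructor
  · obtain ⟨S', hS', hp, hg⟩ := exists_one_le_ratio hT.1 hA
    have hp' : (0 : ℝ) < S'.2 := hp
    have := hle S' hS'
    nlinarith
  · obtain ⟨x, y, hxy, -, -⟩ := exists_uncovered hA
    have hstar : ∀ v, IsStar G c (v, vertexPower c H v) := by
      intro v
      obtain ⟨z, hz⟩ : ∃ z, z ≠ v := by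
        by_contra! hc
        exact hxy.ne ((hc x).trans (hc y).symm)
      obtain ⟨a, b, hab, rfl, -⟩ := hH.2.exists_crossing (fun w => w = v) rfl hz
      obtain ⟨w, hw, he⟩ := exists_vertexPower_eq (c := c) hab
      exact ⟨w, mem_bidirected.1 (hH.1 hw), he⟩
    calc 2 * ((treeCost c T : ℝ) - coverCost G c T A) * S.2
        ≤ (∑ v, gain G c T A (v, vertexPower c H v)) * S.2 := by
          gcongr
          exact two_mul_le_sum_gain hH hT.1.2 A
      _ ≤ ∑ v, gain G c T A S * vertexPower c H v := by
          rw [Finset.sum_mul]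
          exact Finset.sum_le_sum fun v _ => hle _ (hstar v)
      _ = gain G c T A S * power c H := by
          rw [← Finset.mul_sum, power, NNReal.coe_sum]

/-- The integral of `min (1, K / t)` over `0 ≤ t ≤ y`, which bounds the cost of covering the last
edges, of total cost `y`, with `K = opt / 2`. -/
noncomputable def potential (K y : ℝ) : ℝ := if y ≤ K then y else K + K * Real.log (y / K)

lemma mul_log_le {K a b : ℝ} (hK : 0 < K) (ha : 0 < a) (hb : 0 < b) :
    K * (b - a) / b ≤ K * Real.log (b / K) - K * Real.log (a / K) := by
  have h1 : Real.log (a / b) ≤ a / b - 1 := Real.log_le_sub_one_of_pos (by positivity)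
  rw [Real.log_div ha.ne' hb.ne'] at h1
  rw [Real.log_div ha.ne' hK.ne', Real.log_div hb.ne' hK.ne']
  have h2 : K * (b - a) / b = K * (1 - a / b) := by field_simp
  rw [h2, ← mul_sub]
  exact mul_le_mul_of_nonneg_left (by linarith) hK.le

lemma potential_nonneg {K y : ℝ} (hK : 0 ≤ K) (hy : 0 ≤ y) : 0 ≤ potential K y := by
  unfold potential
  split_ifs with h
  · exact hy
  · rcases hK.eq_or_lt with rfl | hK
    · simp
    · have : 0 ≤ Real.log (y / K) := Real.log_nonneg (by rw [le_div_iff₀ hK]; linarith)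
      positivity

/-- A step that decreases the uncovered cost from `y` to `y - g` and costs at most
`g min (1, K / y)` is paid for by the drop of the potential. -/
lemma le_potential_sub {K y g r : ℝ} (hK : 0 < K) (hg : 0 ≤ g) (hrg : r ≤ g)
    (hr : y * r ≤ g * K) : r ≤ potential K y - potential K (y - g) := by
  unfold potential
  by_cases h : y ≤ K
  · rw [if_pos h, if_pos (by linarith)]; linarith
  rw [if_neg h]
  push Not at h
  have hy : 0 < y := hK.trans h
  have hr' : r ≤ K * g / y := by rw [le_div_iff₀ hy]; linarith
  split_ifs with h'
  · -- the step crosses the threshold: compare with `K` in place of `y - g`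
    have h1 := mul_log_le hK hK hy
    rw [div_self hK.ne', Real.log_one, mul_zero, sub_zero] at h1
    have h2 : K * g / y ≤ K - (y - g) + K * (y - K) / y := by
      have h3 : K * g / y - K * (y - K) / y = K / y * (g - (y - K)) := by ring
      have h4 : K / y ≤ 1 := (div_le_one hy).2 h.le
      have h5 := mul_le_of_le_one_left (show 0 ≤ g - (y - K) by linarith) h4
      linarith
    linarith
  · have h1 := mul_log_le hK (show 0 < y - g by linarith) hy
    rw [sub_sub_cancel] at h1
    linarith

lemma potential_add_le {F y : ℝ} (hF : 0 ≤ F) (hFy : F ≤ y) :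
    potential (y / 2) F + F ≤ beta (1 / 2) * y := by
  have hlog : 0 < Real.log 2 := Real.log_pos (by norm_num)
  have hb : beta (1 / 2) = 3 / 2 + Real.log 2 / 2 := by
    rw [beta]; norm_num; ring
  rw [hb]
  unfold potential
  split_ifs with h
  · nlinarith
  · have hy : 0 < y := by linarith
    have : Real.log (F / (y / 2)) ≤ Real.log 2 := by
      refine Real.log_le_log (by apply div_pos <;> linarith) ?_
      rw [div_le_iff₀ (by linarith)]; linarith
    nlinarith

lemma beta_half_le : beta (1 / 2) ≤ 1.85 := by
  have hb : beta (1 / 2) = 3 / 2 + Real.log 2 / 2 := by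
    rw [beta]; norm_num; ring
  rw [hb]
  have := Real.log_two_lt_d9
  norm_num
  linarith

/-- The cost of the chosen stars is at most the drop of the potential. -/
lemma sum_radii_le (hT : IsMST G c T) {H : Finset (V × V)} (hH : IsSolution G H)
    {A : Finset (V × ℝ≥0)} {M : Finset (V × V)} (h : GreedyReach G c T A M) :
    ((∑ S ∈ A, S.2 : ℝ≥0) : ℝ) +
      potential (power c H / 2) (treeCost c T - coverCost G c T A) ≤
        potential (power c H / 2) (treeCost c T) := by
  classical
  induction h with
  | init => simp [coverCost, QAll]
  | step A M S _ hlt _ hmax ih =>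
    have hlt' : (coverCost G c T A : ℝ) < treeCost c T := hlt
    have hpow : (treeCost c T : ℝ) ≤ power c H := hT.treeCost_le_power hH
    have h0 : (0 : ℝ) ≤ coverCost G c T A := NNReal.coe_nonneg _
    obtain ⟨h1, h2⟩ := greedy_choice hT hH hlt hmax
    have hins := coverCost_add_gain (G := G) (c := c) (T := T) A S
    have hle : (coverCost G c T (insert S A) : ℝ) ≤ treeCost c T :=
      coverCost_le hT.1.2 _
    have hsum : ((∑ S ∈ insert S A, S.2 : ℝ≥0) : ℝ) ≤ S.2 + ((∑ S ∈ A, S.2 : ℝ≥0) : ℝ) := by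
      rw [← NNReal.coe_add, NNReal.coe_le_coe]
      by_cases hS : S ∈ A
      · rw [Finset.insert_eq_of_mem hS]; exact le_add_self
      · rw [Finset.sum_insert hS]
    have := le_potential_sub (K := power c H / 2) (y := treeCost c T - coverCost G c T A)
      (g := gain G c T A S) (r := S.2) (by linarith) (gain_nonneg A S) h1 (by linarith)
    rw [← hins, ← sub_sub]
    linarith

theorem IsGreedyOutput.isSolution {H : Finset (V × V)} (h : IsGreedyOutput G c H) :
    IsSolution G H := by
  obtain ⟨T, hT, A, M, hr, -, rfl⟩ := h
  exact (greedyInv hT.1.2 hr).isSolution hT.1.1 hT.1.2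

theorem IsGreedyOutput.power_le {H : Finset (V × V)} (h : IsGreedyOutput G c H) {opt : ℝ≥0}
    (hopt : IsOpt G c opt) : (power c H : ℝ) ≤ beta (1 / 2) * opt := by
  classical
  obtain ⟨T, hT, A, M, hr, hend, rfl⟩ := h
  obtain ⟨⟨Hopt, hH, rfl⟩, -⟩ := hopt
  have hpow : (treeCost c T : ℝ) ≤ power c Hopt := hT.treeCost_le_power hH
  have h1 : (power c (A.biUnion (starArcs G c) ∪ M) : ℝ) ≤
      ((∑ S ∈ A, S.2 : ℝ≥0) : ℝ) + ((∑ a ∈ M, c s(a.1, a.2) : ℝ≥0) : ℝ) := by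
    rw [← NNReal.coe_add, NNReal.coe_le_coe]
    exact (power_union_le _ _).trans (add_le_add (power_stars_le A) (power_le_sum M))
  have h2 : ((∑ a ∈ M, c s(a.1, a.2) : ℝ≥0) : ℝ) + coverCost G c T A ≤ 2 * treeCost c T := by
    exact_mod_cast (greedyInv hT.1.2 hr).cost
  have h3 := sum_radii_le hT hH hr
  have h4 : (treeCost c T : ℝ) = coverCost G c T A := by
    exact_mod_cast le_antisymm (not_lt.1 hend) (coverCost_le hT.1.2 A)
  have h5 := potential_nonneg (K := power c Hopt / 2)
    (y := treeCost c T - coverCost G c T A) (by positivity) (by linarith)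
  have h6 := potential_add_le (NNReal.coe_nonneg (treeCost c T)) hpow
  linarith

end

/-! ### Structured programs and their running time -/

section

/-- Programs without unbounded loops: `forLoop k P` runs `P` with the scalar variable `k` equal to
`0, …, n - 1`, where `n` is the content of the scalar variable `0`. -/
inductive SProg where
  | skip
  | natStore (a : ℕ) (i j : NExp) (e : NExp)
  | realStore (a : ℕ) (i j : NExp) (e : RExp)
  | seq (P P' : SProg)
  | ite (b : Test) (P P' : SProg)
  | forLoop (k : ℕ) (P : SProg)

/-- The scalar variable stored in the cell `(0, 0)` of the array `k`. -/
def scalar (k : ℕ) : NExp := .read k (.lit 0) (.lit 0)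

namespace SProg

/-- The while-program that a structured program stands for. -/
def compile : SProg → Prog
  | skip => .skip
  | natStore a i j e => .natStore a i j e
  | realStore a i j e => .realStore a i j e
  | seq P P' => .seq P.compile P'.compile
  | ite b P P' => .ite b P.compile P'.compile
  | forLoop k P => .seq (.natStore k (.lit 0) (.lit 0) (.lit 0))
      (.loop (.neg (.natLe (scalar 0) (scalar k)))
        (.seq P.compile (.natStore k (.lit 0) (.lit 0) (.add (scalar k) (.lit 1)))))

/-- The memory after `i` rounds of a loop with counter `k` and body `f`. -/
def rounds (k : ℕ) (f : Memory → Memory) (m : Memory) : ℕ → Memory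
  | 0 => m.setNat k 0 0 0
  | i + 1 => (f (rounds k f m i)).setNat k 0 0 (i + 1)

open Classical in
/-- The memory in which a structured program halts. For a loop this is the right value only under
`LoopsOK`. -/
noncomputable def run : SProg → Memory → Memory
  | skip, m => m
  | natStore a i j e, m => m.setNat a (i.eval m) (j.eval m) (e.eval m)
  | realStore a i j e, m => m.setReal a (i.eval m) (j.eval m) (e.eval m)
  | seq P P', m => P'.run (P.run m)
  | ite b P P', m => if b.Holds m then P.run m else P'.run m
  | forLoop k P, m => rounds k P.run m (m.nat 0 0 0)

/-- The program may change the array `k` of naturals; loop counters included. -/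
def WritesNat : SProg → ℕ → Prop
  | skip, _ => False
  | natStore a _ _ _, k => k = a
  | realStore _ _ _ _, _ => False
  | seq P P', k => P.WritesNat k ∨ P'.WritesNat k
  | ite _ P P', k => P.WritesNat k ∨ P'.WritesNat k
  | forLoop l P, k => k = l ∨ P.WritesNat k

/-- The program may change the array `k` of reals. -/
def WritesReal : SProg → ℕ → Prop
  | skip, _ => False
  | natStore _ _ _ _, _ => False
  | realStore a _ _ _, k => k = a
  | seq P P', k => P.WritesReal k ∨ P'.WritesReal k
  | ite _ P P', k => P.WritesReal k ∨ P'.WritesReal k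
  | forLoop _ P, k => P.WritesReal k

/-- No loop body changes the counter or the bound `n` of its loop. -/
def LoopsOK : SProg → Prop
  | skip => True
  | natStore _ _ _ _ => True
  | realStore _ _ _ _ => True
  | seq P P' => P.LoopsOK ∧ P'.LoopsOK
  | ite _ P P' => P.LoopsOK ∧ P'.LoopsOK
  | forLoop k P => k ≠ 0 ∧ ¬ P.WritesNat 0 ∧ ¬ P.WritesNat k ∧ P.LoopsOK

/-- A bound, as a polynomial in `n`, for the number of steps. -/
noncomputable def time : SProg → Polynomial ℕ
  | skip => 1
  | natStore _ _ _ _ => 1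
  | realStore _ _ _ _ => 1
  | seq P P' => P.time + P'.time
  | ite _ P P' => P.time + P'.time + 1
  | forLoop _ P => Polynomial.X * (P.time + 2) + 2

end SProg

lemma setNat_nat (m : Memory) (a i j v a' i' j' : ℕ) : (m.setNat a i j v).nat a' i' j' =
    if a' = a ∧ i' = i ∧ j' = j then v else m.nat a' i' j' := rfl

lemma setNat_nat_of_ne (m : Memory) {a a' : ℕ} (h : a' ≠ a) (i j v : ℕ) :
    (m.setNat a i j v).nat a' = m.nat a' := by
  funext i' j'; simp [setNat_nat, h]

@[simp] lemma setNat_real (m : Memory) (a i j v : ℕ) : (m.setNat a i j v).real = m.real := rfl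

lemma setReal_real (m : Memory) (a i j : ℕ) (v : ℝ) (a' i' j' : ℕ) :
    (m.setReal a i j v).real a' i' j' =
      if a' = a ∧ i' = i ∧ j' = j then v else m.real a' i' j' := rfl

lemma setReal_real_of_ne (m : Memory) {a a' : ℕ} (h : a' ≠ a) (i j : ℕ) (v : ℝ) :
    (m.setReal a i j v).real a' = m.real a' := by
  funext i' j'; simp [setReal_real, h]

namespace SProg

lemma run_ite_of_pos {b : Test} {P P' : SProg} {m : Memory} (h : b.Holds m) :
    (ite b P P').run m = P.run m := by
  rw [run, if_pos h]

lemma run_ite_of_neg {b : Test} {P P' : SProg} {m : Memory} (h : ¬ b.Holds m) :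
    (ite b P P').run m = P'.run m := by
  rw [run, if_neg h]

lemma run_nat (P : SProg) {a : ℕ} (h : ¬ P.WritesNat a) (m : Memory) :
    (P.run m).nat a = m.nat a := by
  induction P generalizing m with
  | skip => rfl
  | natStore a' i j e => exact setNat_nat_of_ne _ h _ _ _
  | realStore a' i j e => rfl
  | seq P P' ih ih' =>
    simp only [WritesNat, not_or] at h
    rw [run, ih' h.2, ih h.1]
  | ite b P P' ih ih' =>
    simp only [WritesNat, not_or] at h
    rw [run]
    split_ifs
    exacts [ih h.1 m, ih' h.2 m]
  | forLoop k P ih =>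
    simp only [WritesNat, not_or] at h
    rw [run]
    generalize m.nat 0 0 0 = n
    induction n with
    | zero => exact setNat_nat_of_ne _ h.1 _ _ _
    | succ n ihn => rw [rounds, setNat_nat_of_ne _ h.1, ih h.2, ihn]

lemma run_real (P : SProg) {a : ℕ} (h : ¬ P.WritesReal a) (m : Memory) :
    (P.run m).real a = m.real a := by
  induction P generalizing m with
  | skip => rfl
  | natStore a' i j e => rfl
  | realStore a' i j e => exact setReal_real_of_ne _ h _ _ _
  | seq P P' ih ih' =>
    simp only [WritesReal, not_or] at h
    rw [run, ih' h.2, ih h.1]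
  | ite b P P' ih ih' =>
    simp only [WritesReal, not_or] at h
    rw [run]
    split_ifs
    exacts [ih h.1 m, ih' h.2 m]
  | forLoop k P ih =>
    simp only [WritesReal] at h
    rw [run]
    generalize m.nat 0 0 0 = n
    induction n with
    | zero => rfl
    | succ n ihn => rw [rounds, setNat_real, ih h, ihn]

lemma rounds_counter (k : ℕ) (f : Memory → Memory) (m : Memory) (i : ℕ) :
    (rounds k f m i).nat k 0 0 = i := by
  cases i <;> simp [rounds, setNat_nat]

lemma rounds_nat {k : ℕ} {P : SProg} {a : ℕ} (hk : a ≠ k) (h : ¬ P.WritesNat a) (m : Memory)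
    (i : ℕ) : (rounds k P.run m i).nat a = m.nat a := by
  induction i with
  | zero => exact setNat_nat_of_ne _ hk _ _ _
  | succ n ihn => rw [rounds, setNat_nat_of_ne _ hk, P.run_nat h, ihn]

lemma rounds_real {k : ℕ} {P : SProg} {a : ℕ} (h : ¬ P.WritesReal a) (m : Memory)
    (i : ℕ) : (rounds k P.run m i).real a = m.real a := by
  induction i with
  | zero => rfl
  | succ n ihn => rw [rounds, setNat_real, P.run_real h, ihn]

/-- A structured program runs within the polynomial time bound read off from its text. -/
theorem exists_exec (P : SProg) (hP : P.LoopsOK) (hP0 : ¬ P.WritesNat 0) (m : Memory) :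
    ∃ t ≤ P.time.eval (m.nat 0 0 0), Exec P.compile m t (P.run m) := by
  induction P generalizing m with
  | skip => exact ⟨1, by simp [time], .skip m⟩
  | natStore a i j e => exact ⟨1, by simp [time], .natStore a i j e m⟩
  | realStore a i j e => exact ⟨1, by simp [time], .realStore a i j e m⟩
  | seq P P' ih ih' =>
    simp only [WritesNat, not_or] at hP0
    obtain ⟨t, ht, h⟩ := ih hP.1 hP0.1 m
    obtain ⟨t', ht', h'⟩ := ih' hP.2 hP0.2 (P.run m)
    rw [P.run_nat hP0.1] at ht'
    exact ⟨t + t', by simpa [time] using add_le_add ht ht', .seq h h'⟩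
  | ite b P P' ih ih' =>
    simp only [WritesNat, not_or] at hP0
    rw [run]
    split_ifs with hb
    · obtain ⟨t, ht, h⟩ := ih hP.1 hP0.1 m
      exact ⟨t + 1, by simp [time]; omega, .iteTrue hb h⟩
    · obtain ⟨t, ht, h⟩ := ih' hP.2 hP0.2 m
      exact ⟨t + 1, by simp [time]; omega, .iteFalse hb h⟩
  | forLoop k P ih =>
    obtain ⟨hk, -, hPk, hloops⟩ := hP
    simp only [WritesNat, not_or] at hP0
    set n := m.nat 0 0 0 with hn
    -- `j` is the number of rounds that are left
    have key : ∀ j ≤ n, ∃ t ≤ j * (P.time.eval n + 2) + 1,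
        Exec (.loop (.neg (.natLe (scalar 0) (scalar k)))
          (.seq P.compile (.natStore k (.lit 0) (.lit 0) (.add (scalar k) (.lit 1)))))
          (rounds k P.run m (n - j)) t (rounds k P.run m n) := by
      intro j
      induction j with
      | zero =>
        refine fun _ => ⟨1, by simp, .loopFalse ?_⟩
        simp [Test.Holds, scalar, NExp.eval, rounds_counter, rounds_nat hP0.1 hP0.2, ← hn]
      | succ j ihj =>
        intro hj
        obtain ⟨t', ht', h'⟩ := ihj (by omega)
        obtain ⟨t, ht, h⟩ := ih hloops hP0.2 (rounds k P.run m (n - (j + 1)))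
        rw [rounds_nat hP0.1 hP0.2, ← hn] at ht
        refine ⟨(t + 1) + t' + 1, ?_, .loopTrue ?_ (.seq h ?_) h'⟩
        · rw [Nat.succ_mul]; omega
        · simp only [Test.Holds, scalar, NExp.eval, rounds_counter, rounds_nat hP0.1 hP0.2, ← hn]
          omega
        · have hs : n - j = n - (j + 1) + 1 := by omega
          have hst := Exec.natStore k (.lit 0) (.lit 0) (.add (scalar k) (.lit 1))
            (P.run (rounds k P.run m (n - (j + 1))))
          have he : (NExp.add (scalar k) (.lit 1)).eval
              (P.run (rounds k P.run m (n - (j + 1)))) = n - (j + 1) + 1 := by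
            simp only [scalar, NExp.eval, P.run_nat hPk, rounds_counter]
          rw [he] at hst
          rw [hs]
          exact hst
    obtain ⟨t, ht, h⟩ := key n le_rfl
    rw [Nat.sub_self] at h
    refine ⟨1 + t, ?_, .seq (.natStore k (.lit 0) (.lit 0) (.lit 0) m) h⟩
    simp [time]
    omega

/-- Induction over the rounds of a loop. The invariant `I` must not depend on the counter; the body
may use that the arrays which the loop does not write are unchanged since its start. -/
theorem forLoop_induct {k : ℕ} {P : SProg} {m : Memory} {n : ℕ} (hn : m.nat 0 0 0 = n)
    (I : ℕ → Memory → Prop)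
    (hI : ∀ i m v, I i m → I i (m.setNat k 0 0 v)) (h0 : I 0 m)
    (hstep : ∀ i < n, ∀ m', (∀ a, ¬ (forLoop k P).WritesNat a → m'.nat a = m.nat a) →
      (∀ a, ¬ (forLoop k P).WritesReal a → m'.real a = m.real a) →
      m'.nat k 0 0 = i → I i m' → I (i + 1) (P.run m')) :
    I n ((forLoop k P).run m) := by
  have key : ∀ i ≤ n, I i (rounds k P.run m i) := by
    intro i
    induction i with
    | zero => exact fun _ => hI _ _ _ h0
    | succ i ih =>
      intro hi
      refine hI _ _ _ (hstep i hi _ ?_ ?_ (rounds_counter ..) (ih (by omega)))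
      · intro a ha
        simp only [WritesNat, not_or] at ha
        exact rounds_nat ha.1 ha.2 m i
      · intro a ha
        exact rounds_real (P := P) ha m i
  rw [run, hn]
  exact key n le_rfl

end SProg

end

/-! ### Growing and representing a rooted minimum spanning tree -/

section

variable {V : Type*}

/-- A part of a spanning tree that is rooted at `r` and has the vertex set `S`: `par` gives the
parents, and `anc w v` says that `w ≠ r` and that `v` is in the subtree below `w`. -/
structure RootedTree (S : Set V) (r : V) (par : V → V) (anc : V → V → Prop) : Prop where
  root_mem : r ∈ S
  par_mem : ∀ v ∈ S, v ≠ r → par v ∈ S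
  anc_self : ∀ w ∈ S, w ≠ r → anc w w
  anc_par_self : ∀ w ∈ S, w ≠ r → ¬ anc w (par w)
  anc_par : ∀ w, ∀ v ∈ S, v ≠ r → v ≠ w → (anc w v ↔ anc w (par v))
  anc_root : ∀ v, ¬ anc r v
  anc_of_notMem : ∀ w ∉ S, ∀ v, ¬ anc w v

/-- Attaching a new leaf `y` below `x`. -/
lemma RootedTree.insert [DecidableEq V] {S : Set V} {r : V} {par : V → V} {anc : V → V → Prop}
    (h : RootedTree S r par anc) {x y : V} (hx : x ∈ S) (hy : y ∉ S) :
    RootedTree (insert y S) r (Function.update par y x)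
      (fun w v => if v = y then w = y ∨ anc w x else anc w v) := by
  have hyr : y ≠ r := fun e => hy (e ▸ h.root_mem)
  have hne : ∀ v ∈ S, v ≠ y := fun v hv e => hy (e ▸ hv)
  have hpar : ∀ v ∈ S, Function.update par y x v = par v := fun v hv =>
    Function.update_of_ne (hne v hv) _ _
  constructor
  · exact Set.mem_insert_of_mem _ h.root_mem
  · rintro v (rfl | hv) hvr
    · rw [Function.update_self]; exact Set.mem_insert_of_mem _ hx
    · rw [hpar v hv]; exact Set.mem_insert_of_mem _ (h.par_mem v hv hvr)
  · rintro w (rfl | hw) hwr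
    · simp
    · simpa [hne w hw] using h.anc_self w hw hwr
  · rintro w (rfl | hw) hwr
    · rw [Function.update_self, if_neg (hne x hx)]
      exact h.anc_of_notMem _ hy _
    · rw [hpar w hw, if_neg (hne _ (h.par_mem w hw hwr))]
      exact h.anc_par_self w hw hwr
  · rintro w v (rfl | hv) hvr hvw
    · rw [Function.update_self, if_pos rfl, if_neg (hne x hx)]
      simp [hvw.symm]
    · rw [hpar v hv, if_neg (hne v hv), if_neg (hne _ (h.par_mem v hv hvr))]
      exact h.anc_par w v hv hvr hvw
  · intro v
    split_ifs
    · simpa [hyr.symm] using h.anc_root x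
    · exact h.anc_root v
  · intro w hw v
    rw [Set.mem_insert_iff, not_or] at hw
    split_ifs
    · simpa [hw.1] using h.anc_of_notMem w hw.2 x
    · exact h.anc_of_notMem w hw.2 v

lemma exists_crossing_edge {G : SimpleGraph V} (hG : G.Connected) {S : Set V} {r v : V} (hr : r ∈ S) (hv : v ∉ S) :
    ∃ a b, a ∈ S ∧ b ∉ S ∧ G.Adj a b := by
  obtain ⟨p⟩ := hG.preconnected r v
  obtain ⟨d, -, h1, h2⟩ := p.exists_boundary_dart S hr hv
  exact ⟨_, _, h1, h2, d.adj⟩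

/-- Distinct vertices have distinct parent edges. -/
lemma RootedTree.injOn {r : V} {par : V → V} {anc : V → V → Prop}
    (h : RootedTree Set.univ r par anc) {v w : V} (hv : v ≠ r) (hw : w ≠ r)
    (he : s(v, par v) = s(w, par w)) : v = w := by
  rcases Sym2.eq_iff.1 he with ⟨h1, -⟩ | ⟨h1, h2⟩
  · exact h1
  · by_contra hne
    have h3 := h.anc_par_self w trivial hw
    rw [← h1, h.anc_par w v trivial hv hne, h2] at h3
    exact h3 (h.anc_self w trivial hw)

variable [Fintype V] {G T : SimpleGraph V} {c : Sym2 V → ℝ≥0}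

lemma exists_isMST (hG : G.Connected) : ∃ T, IsMST G c T := by
  classical
  have hfin : {T | IsSpanningTree G T}.Finite := Set.toFinite _
  obtain ⟨T, hT, hmin⟩ := Set.exists_min_image _ (treeCost c) hfin (by
    obtain ⟨T, h, h'⟩ := hG.exists_isTree_le
    exact ⟨T, h, h'⟩)
  exact ⟨T, hT, fun T' hT' => hmin T' hT'⟩

/-- The cut property: an edge of least cost among the edges that leave `S` can be added to a part
of a minimum spanning tree all of whose edges are inside `S`. -/
lemma IsMST.exists_insert (hT : IsMST G c T) {S : Set V} {x y : V} (hx : x ∈ S) (hy : y ∉ S)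
    (hxy : G.Adj x y)
    (hmin : ∀ a b, a ∈ S → b ∉ S → G.Adj a b → c s(x, y) ≤ c s(a, b)) :
    ∃ T', IsMST G c T' ∧ T'.Adj x y ∧ ∀ a b, a ∈ S → b ∈ S → T.Adj a b → T'.Adj a b := by
  obtain ⟨p, hp⟩ := (hT.1.2.connected.preconnected x y).exists_isPath
  obtain ⟨d, hd, hdS, hdS'⟩ := p.exists_boundary_dart S hx hy
  have hs : Sep T s(d.fst, d.snd) x y :=
    (mem_edges_iff_sep hT.1.2.isAcyclic hp _).1 (List.mem_map_of_mem hd)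
  obtain ⟨h1, h2⟩ := hT.1.exchange (c := c) hs hxy
  refine ⟨_, ⟨h1, fun T' hT' => le_trans ?_ (hT.2 T' hT')⟩, ?_, ?_⟩
  · have := hmin _ _ hdS hdS' (hT.1.1 d.adj)
    refine le_of_add_le_add_right (a := c s(d.fst, d.snd)) ?_
    rw [h2]
    gcongr
  · simp [SimpleGraph.edge_adj, hxy.ne]
  · intro a b ha hb hab
    refine Or.inl ((SimpleGraph.deleteEdges_adj ..).2 ⟨hab, fun he => ?_⟩)
    rcases Sym2.eq_iff.1 he with ⟨-, rfl⟩ | ⟨rfl, -⟩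
    exacts [hdS' hb, hdS' ha]

/-- A part of a minimum spanning tree, as it is grown by Prim's algorithm. -/
structure PrimInv (G : SimpleGraph V) (c : Sym2 V → ℝ≥0) (S : Set V) (r : V) (par : V → V)
    (anc : V → V → Prop) : Prop where
  tree : RootedTree S r par anc
  mst : ∃ T, IsMST G c T ∧ ∀ v ∈ S, v ≠ r → T.Adj v (par v)

lemma PrimInv.insert [DecidableEq V] {S : Set V} {r : V} {par : V → V} {anc : V → V → Prop}
    (h : PrimInv G c S r par anc) {x y : V} (hx : x ∈ S) (hy : y ∉ S) (hxy : G.Adj x y)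
    (hmin : ∀ a b, a ∈ S → b ∉ S → G.Adj a b → c s(x, y) ≤ c s(a, b)) :
    PrimInv G c (insert y S) r (Function.update par y x)
      (fun w v => if v = y then w = y ∨ anc w x else anc w v) := by
  refine ⟨h.tree.insert hx hy, ?_⟩
  obtain ⟨T, hT, hadj⟩ := h.mst
  obtain ⟨T', hT', h1, h2⟩ := hT.exists_insert hx hy hxy hmin
  refine ⟨T', hT', ?_⟩
  rintro v (rfl | hv) hvr
  · rw [Function.update_self]; exact h1.symm
  · rw [Function.update_of_ne (by rintro rfl; exact hy hv)]
    exact h2 _ _ hv (h.tree.par_mem v hv hvr) (hadj v hv hvr)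

/-- By counting, every edge of the tree is the parent edge of some vertex. -/
lemma RootedTree.exists_eq {r : V} {par : V → V} {anc : V → V → Prop}
    (h : RootedTree Set.univ r par anc) (hT : T.IsTree) (hadj : ∀ v ≠ r, T.Adj v (par v))
    {e : Sym2 V} (he : e ∈ T.edgeSet) : ∃ w ≠ r, e = s(w, par w) := by
  classical
  have hsub : (Finset.univ.erase r).image (fun v => s(v, par v)) ⊆ T.edgeFinset := by
    intro e he
    obtain ⟨v, hv, rfl⟩ := Finset.mem_image.1 he
    rw [SimpleGraph.mem_edgeFinset]
    exact hadj v (Finset.ne_of_mem_erase hv)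
  have heq := Finset.eq_of_subset_of_card_le hsub (by
    rw [Finset.card_image_of_injOn, Finset.card_erase_of_mem (Finset.mem_univ _),
      Finset.card_univ, ← hT.card_edgeFinset, Nat.add_sub_cancel]
    intro v hv w hw he
    exact h.injOn (Finset.ne_of_mem_erase hv) (Finset.ne_of_mem_erase hw) he)
  rw [← SimpleGraph.mem_edgeFinset, ← heq] at he
  obtain ⟨v, hv, rfl⟩ := Finset.mem_image.1 he
  exact ⟨v, Finset.ne_of_mem_erase hv, rfl⟩

/-- Removing the parent edge of `w` separates the subtree below `w` from the rest. -/
lemma RootedTree.reachable_iff {r : V} {par : V → V} {anc : V → V → Prop}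
    (h : RootedTree Set.univ r par anc) (hT : T.IsTree) (hadj : ∀ v ≠ r, T.Adj v (par v))
    {w : V} (hw : w ≠ r) (x y : V) :
    (T.deleteEdges {s(w, par w)}).Reachable x y ↔ (anc w x ↔ anc w y) := by
  have key : ∀ x y, (T.deleteEdges {s(w, par w)}).Reachable x y → (anc w x ↔ anc w y) := by
    rintro x y ⟨p⟩
    induction p with
    | nil => rfl
    | @cons x z y hxz q ih =>
      refine Iff.trans ?_ ih
      obtain ⟨hxz, hne⟩ := (SimpleGraph.deleteEdges_adj ..).1 hxz
      obtain ⟨v, hv, he⟩ := h.exists_eq hT hadj (e := s(x, z)) hxz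
      have hvw : v ≠ w := by
        rintro rfl
        exact hne he
      have := h.anc_par w v trivial hv hvw
      rcases Sym2.eq_iff.1 he with ⟨rfl, rfl⟩ | ⟨rfl, rfl⟩
      exacts [this, this.symm]
  refine ⟨key x y, fun hxy => ?_⟩
  have h1 := h.anc_self w trivial hw
  have h2 := h.anc_par_self w trivial hw
  rcases reachable_ends hT.connected w (par w) x with hx | hx <;>
  rcases reachable_ends hT.connected w (par w) y with hy | hy <;>
  have hx' := key _ _ hx <;> have hy' := key _ _ hy
  · exact hx.trans hy.symm
  · tauto
  · tauto
  · exact hx.trans hy.symm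

/-- A rooted minimum spanning tree, with the data by which the program represents it. -/
structure RootedMST (G : SimpleGraph V) (c : Sym2 V → ℝ≥0) (T : SimpleGraph V) (r : V)
    (par : V → V) (anc : V → V → Prop) : Prop where
  mst : IsMST G c T
  tree : RootedTree Set.univ r par anc
  adj : ∀ v ≠ r, T.Adj v (par v)

lemma PrimInv.rootedMST {r : V} {par : V → V} {anc : V → V → Prop}
    (h : PrimInv G c Set.univ r par anc) : ∃ T, RootedMST G c T r par anc := by
  obtain ⟨T, hT, hadj⟩ := h.mst
  exact ⟨T, hT, h.tree, fun v hv => hadj v trivial hv⟩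

namespace RootedMST

variable {r : V} {par : V → V} {anc : V → V → Prop}

lemma exists_eq (h : RootedMST G c T r par anc) {e : Sym2 V} (he : e ∈ T.edgeSet) :
    ∃ w ≠ r, e = s(w, par w) :=
  h.tree.exists_eq h.mst.1.2 h.adj he

lemma mem_QStar_iff (h : RootedMST G c T r par anc) {w : V} (hw : w ≠ r) {S : V × ℝ≥0} :
    s(w, par w) ∈ QStar G c T S ↔
      ∃ z, G.Adj S.1 z ∧ c s(S.1, z) ≤ S.2 ∧ ¬ (anc w S.1 ↔ anc w z) := by
  rw [mem_QStar h.mst.1.2]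
  simp only [Sep, h.tree.reachable_iff h.mst.1.2 h.adj hw, mem_starVerts]
  constructor
  · rintro ⟨z, rfl | hz, hs⟩
    · exact absurd Iff.rfl hs
    · exact ⟨z, hz.1, hz.2, hs⟩
  · rintro ⟨z, h1, h2, hs⟩
    exact ⟨z, .inr ⟨h1, h2⟩, hs⟩

open Classical in
lemma gain_eq_sum (h : RootedMST G c T r par anc) (A : Finset (V × ℝ≥0)) (S : V × ℝ≥0) :
    gain G c T A S = ∑ w, if w ≠ r ∧ s(w, par w) ∈ QStar G c T S ∧ s(w, par w) ∉ QAll G c T A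
      then (c s(w, par w) : ℝ) else 0 := by
  rw [gain_eq, NNReal.coe_sum, ← Finset.sum_filter]
  symm
  refine Finset.sum_bij (fun w _ => s(w, par w)) ?_ ?_ ?_ (fun _ _ => rfl)
  · intro w hw
    exact Finset.mem_sdiff.2 (Finset.mem_filter.1 hw).2.2
  · intro v hv w hw he
    exact h.tree.injOn (Finset.mem_filter.1 hv).2.1 (Finset.mem_filter.1 hw).2.1 he
  · intro e he
    obtain ⟨h1, h2⟩ := Finset.mem_sdiff.1 he
    obtain ⟨w, hw, rfl⟩ := h.exists_eq (QStar_subset_edgeSet h.mst.1.2 h1)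
    exact ⟨w, by simp [hw, h1, h2], rfl⟩

/-- In terms of `par` and `anc`: the arcs that are removed when a star is chosen. -/
lemma mem_newArcs_iff (h : RootedMST G c T r par anc) {A : Finset (V × ℝ≥0)} {S : V × ℝ≥0}
    {a b : V} : (a, b) ∈ newArcs G c T A S ↔
      ∃ w ≠ r, s(w, par w) ∈ QStar G c T S ∧ s(w, par w) ∉ QAll G c T A ∧
        (anc w S.1 ∧ a = w ∧ b = par w ∨ ¬ anc w S.1 ∧ a = par w ∧ b = w) := by
  rw [mem_newArcs h.mst.1.2]
  constructor
  · rintro ⟨h1, h2, h3⟩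
    obtain ⟨w, hw, he⟩ := h.exists_eq (QStar_subset_edgeSet h.mst.1.2 h1)
    rw [he] at h1 h2 h3
    rw [h.tree.reachable_iff h.mst.1.2 h.adj hw] at h3
    refine ⟨w, hw, h1, h2, ?_⟩
    have h4 := h.tree.anc_self w trivial hw
    have h5 := h.tree.anc_par_self w trivial hw
    rcases Sym2.eq_iff.1 he with ⟨rfl, rfl⟩ | ⟨rfl, rfl⟩
    · exact .inl ⟨h3.2 h4, rfl, rfl⟩
    · exact .inr ⟨fun h6 => h5 (h3.1 h6), rfl, rfl⟩
  · rintro ⟨w, hw, h1, h2, ⟨h3, rfl, rfl⟩ | ⟨h3, rfl, rfl⟩⟩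
    · refine ⟨h1, h2, (h.tree.reachable_iff h.mst.1.2 h.adj hw _ _).2 ?_⟩
      exact iff_of_true h3 (h.tree.anc_self _ trivial hw)
    · rw [Sym2.eq_swap]
      refine ⟨h1, h2, (h.tree.reachable_iff h.mst.1.2 h.adj hw _ _).2 ?_⟩
      exact iff_of_false h3 (h.tree.anc_par_self _ trivial hw)

end RootedMST

end

/-! ### Searching for a best pair of vertices -/

section

/-- The test `e ≠ 0`. -/
def Test.nonzero (e : NExp) : Test := .natLe (.lit 1) e

@[simp] lemma Test.holds_nonzero (m : Memory) (e : NExp) :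
    (Test.nonzero e).Holds m ↔ e.eval m ≠ 0 := by
  simp [Test.nonzero, Test.Holds, NExp.eval, Nat.one_le_iff_ne_zero]

@[simp] lemma eval_scalar (m : Memory) (k : ℕ) : (scalar k).eval m = m.nat k 0 0 := rfl

namespace SProg

/-- Assign `e` to the scalar variable `k`. -/
def setScalar (k : ℕ) (e : NExp) : SProg := natStore k (.lit 0) (.lit 0) e

/-- Replace the best pair so far by the pair under inspection if there is none so far, or if the
test `better` succeeds. -/
def keepBest (better : Test) : SProg :=
  ite (.conj (.nonzero (scalar 15)) (.neg better)) skip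
    (seq (setScalar 16 (scalar 11)) (seq (setScalar 17 (scalar 12)) (setScalar 15 (.lit 1))))

/-- Search for a best pair among all pairs of vertices that pass the test `cand`. The pair under
inspection is in the scalars 11 and 12, the best pair so far in the scalars 16 and 17, and the
scalar 15 tells whether there is one. -/
def argBest (cand better : Test) : SProg :=
  seq (setScalar 15 (.lit 0)) (forLoop 11 (forLoop 12 (ite cand (keepBest better) skip)))

lemma argBest_writesNat (cand better : Test) (k : ℕ) : (argBest cand better).WritesNat k ↔
    k = 11 ∨ k = 12 ∨ k = 15 ∨ k = 16 ∨ k = 17 := by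
  simp only [argBest, keepBest, setScalar, WritesNat]; tauto

lemma argBest_writesReal (cand better : Test) (k : ℕ) :
    ¬ (argBest cand better).WritesReal k := by
  simp [argBest, keepBest, setScalar, WritesReal]

lemma argBest_loopsOK (cand better : Test) : (argBest cand better).LoopsOK := by
  simp [argBest, keepBest, setScalar, LoopsOK, WritesNat]

/-- `m` stores a best pair among those pairs in `D` that satisfy `C`. -/
def StoresBest {n : ℕ} (C : Fin n → Fin n → Prop) (ρ : Fin n → Fin n → ℝ)
    (D : Fin n → Fin n → Prop) (m : Memory) : Prop :=
  (m.nat 15 0 0 = 0 ∧ ∀ x y, D x y → ¬ C x y) ∨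
  (m.nat 15 0 0 ≠ 0 ∧ ∃ x y : Fin n, m.nat 16 0 0 = x ∧ m.nat 17 0 0 = y ∧ C x y ∧
    ∀ x' y', D x' y' → C x' y' → ρ x' y' ≤ ρ x y)

/-- Agreement of two memories except in the scalars that the search uses. -/
def SearchAgree (m m' : Memory) : Prop :=
  (∀ a, a ≠ 11 → a ≠ 12 → a ≠ 15 → a ≠ 16 → a ≠ 17 → m'.nat a = m.nat a) ∧ m'.real = m.real

/-- If the test `cand` decides `C` and the test `better` compares the values of `ρ`, then `argBest`
finds a pair that maximizes `ρ` among the pairs with `C`. -/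
theorem argBest_spec {n : ℕ} (C : Fin n → Fin n → Prop) (ρ : Fin n → Fin n → ℝ)
    {cand better : Test} {m : Memory} (hn : m.nat 0 0 0 = n)
    (hcand : ∀ m' (x y : Fin n), SearchAgree m m' → m'.nat 11 0 0 = x → m'.nat 12 0 0 = y →
      (cand.Holds m' ↔ C x y))
    (hbetter : ∀ m' (x y x' y' : Fin n), SearchAgree m m' → m'.nat 11 0 0 = x →
      m'.nat 12 0 0 = y → m'.nat 16 0 0 = x' → m'.nat 17 0 0 = y' → C x y → C x' y' →
      (better.Holds m' ↔ ρ x' y' ≤ ρ x y)) :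
    StoresBest C ρ (fun _ _ => True) ((argBest cand better).run m) := by
  have hstore : ∀ D D' : Fin n → Fin n → Prop, (∀ x y, D' x y ↔ D x y) → ∀ m',
      StoresBest C ρ D m' → StoresBest C ρ D' m' := by
    intro D D' h m'
    obtain rfl : D' = D := by ext; exact h _ _
    exact id
  have hscal : ∀ D k v m', k = 11 ∨ k = 12 → StoresBest C ρ D m' →
      StoresBest C ρ D (m'.setNat k 0 0 v) := by
    rintro D k v m' (rfl | rfl) h <;> simpa [StoresBest, setNat_nat] using h
  rw [argBest, run]
  set m₁ := (setScalar 15 (.lit 0)).run m with hm₁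
  have hag₁ : SearchAgree m m₁ := by
    constructor
    · intro a _ _ h15 _ _
      exact run_nat _ (by simpa [setScalar, WritesNat] using h15) m
    · rfl
  have hn₁ : m₁.nat 0 0 0 = n := by rw [hag₁.1] <;> simp [hn]
  have h0 : StoresBest C ρ (fun _ _ => False) m₁ := by
    left
    simp [hm₁, setScalar, run, setNat_nat, NExp.eval]
  have main := forLoop_induct (k := 11) (P := forLoop 12 (ite cand (keepBest better) skip)) hn₁
    (fun i m' => StoresBest C ρ (fun x _ => x.val < i) m')
    (fun i m' v h => hscal _ _ _ _ (.inl rfl) h)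
    (hstore _ _ (by simp) _ h0) ?_
  · exact hstore _ _ (by simp) _ main
  intro i hi m₂ hnat₂ hreal₂ hi₂ hI
  have hag₂ : SearchAgree m m₂ := by
    constructor
    · intro a h1 h2 h3 h4 h5
      rw [hnat₂ a (by simp [WritesNat, keepBest, setScalar, *]), hag₁.1 a h1 h2 h3 h4 h5]
    · rw [← hag₁.2]
      funext a
      exact hreal₂ a (by simp [WritesReal, keepBest, setScalar])
  have hn₂ : m₂.nat 0 0 0 = n := by rw [hag₂.1] <;> simp [hn]
  have inner := forLoop_induct (k := 12) (P := ite cand (keepBest better) skip) hn₂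
    (fun j m' => StoresBest C ρ (fun x y => x.val < i ∨ x.val = i ∧ y.val < j) m')
    (fun i m' v h => hscal _ _ _ _ (.inr rfl) h)
    (hstore _ _ (by simp) _ hI) ?_
  · refine hstore _ _ ?_ _ inner
    intro x y
    have := y.isLt
    omega
  intro j hj m₃ hnat₃ hreal₃ hj₃ hI
  have hag₃ : SearchAgree m m₃ := by
    constructor
    · intro a h1 h2 h3 h4 h5
      rw [hnat₃ a (by simp [WritesNat, keepBest, setScalar, *]), hag₂.1 a h1 h2 h3 h4 h5]
    · rw [← hag₂.2]
      funext a
      exact hreal₃ a (by simp [WritesReal, keepBest, setScalar])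
  have hi₃ : m₃.nat 11 0 0 = i := by
    rw [hnat₃ 11 (by simp [WritesNat, keepBest, setScalar]), hi₂]
  have hc := hcand m₃ ⟨i, hi⟩ ⟨j, hj⟩ hag₃ hi₃ hj₃
  have hD : ∀ x y : Fin n, (x.val < i ∨ x.val = i ∧ y.val < j + 1) →
      (x.val < i ∨ x.val = i ∧ y.val < j) ∨ (x = ⟨i, hi⟩ ∧ y = ⟨j, hj⟩) := by
    intro x y h
    simp only [Fin.ext_iff]
    omega
  rw [run]
  split_ifs with hcd
  · rw [hc] at hcd
    rw [keepBest, run]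
    split_ifs with hb
    · simp only [Test.Holds, Test.holds_nonzero, eval_scalar] at hb
      obtain ⟨hf, hb⟩ := hb
      rcases hI with ⟨h, -⟩ | ⟨-, x, y, hx, hy, hC, hbest⟩
      · exact absurd h hf
      · rw [hbetter m₃ _ _ x y hag₃ hi₃ hj₃ hx hy hcd hC, not_le] at hb
        refine .inr ⟨hf, x, y, hx, hy, hC, fun x' y' hxy hC' => ?_⟩
        rcases hD x' y' hxy with h | ⟨rfl, rfl⟩
        · exact hbest x' y' h hC'
        · exact hb.le
    · simp only [Test.Holds, Test.holds_nonzero, eval_scalar, not_and, not_not] at hb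
      right
      simp only [run, setScalar, setNat_nat, NExp.eval, eval_scalar]
      refine ⟨by simp, ⟨i, hi⟩, ⟨j, hj⟩, by simpa using hi₃, by simpa using hj₃, hcd, ?_⟩
      intro x' y' hxy hC'
      rcases hD x' y' hxy with h | ⟨rfl, rfl⟩
      · rcases hI with ⟨-, h'⟩ | ⟨hf, x, y, hx, hy, hC, hbest⟩
        · exact absurd hC' (h' x' y' h)
        · refine (hbest x' y' h hC').trans ?_
          rw [← hbetter m₃ _ _ x y hag₃ hi₃ hj₃ hx hy hcd hC]
          exact hb hf
      · exact le_rfl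
  · rw [hc] at hcd
    rcases hI with ⟨hf, h'⟩ | ⟨hf, x, y, hx, hy, hC, hbest⟩
    · refine .inl ⟨hf, fun x' y' hxy => ?_⟩
      rcases hD x' y' hxy with h | ⟨rfl, rfl⟩
      exacts [h' x' y' h, hcd]
    · refine .inr ⟨hf, x, y, hx, hy, hC, fun x' y' hxy hC' => ?_⟩
      rcases hD x' y' hxy with h | ⟨rfl, rfl⟩
      exacts [hbest x' y' h hC', absurd hC' hcd]

end SProg

end

/-! ### Prim's algorithm -/

section

/-- The memory still holds the input. -/
structure HoldsInput {n : ℕ} (G : SimpleGraph (Fin n)) (c : Sym2 (Fin n) → ℝ≥0) (m : Memory) :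
    Prop where
  size : m.nat 0 0 0 = n
  adj : ∀ x y : Fin n, m.nat 1 x y ≠ 0 ↔ G.Adj x y
  cost : ∀ x y : Fin n, G.Adj x y → m.real 0 x y = c s(x, y)

lemma HoldsInput.congr {n : ℕ} {G : SimpleGraph (Fin n)} {c : Sym2 (Fin n) → ℝ≥0} {m m' : Memory}
    (h : HoldsInput G c m) (h0 : m'.nat 0 = m.nat 0) (h1 : m'.nat 1 = m.nat 1)
    (h2 : m'.real 0 = m.real 0) : HoldsInput G c m' :=
  ⟨by rw [h0, h.size], by rw [h1]; exact h.adj, by rw [h2]; exact h.cost⟩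

lemma holdsInput_inputMemory {n : ℕ} (G : SimpleGraph (Fin n)) (c : Sym2 (Fin n) → ℝ≥0) :
    HoldsInput G c (inputMemory G c) := by
  constructor
  · simp [inputMemory]
  · intro x y
    simp [inputMemory]
  · intro x y h
    simp [inputMemory, h]

namespace SProg

/-- The pair in the scalars 11 and 12 is an edge that leaves the set of the array 3. -/
def crossing : Test :=
  .conj (.nonzero (.read 3 (scalar 11) (.lit 0)))
    (.conj (.neg (.nonzero (.read 3 (scalar 12) (.lit 0))))
      (.nonzero (.read 1 (scalar 11) (scalar 12))))

/-- The pair in the scalars 11 and 12 costs at most as much as the pair in the scalars 16 and 17. -/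
def cheaper : Test :=
  .realLe (.read 0 (scalar 11) (scalar 12)) (.read 0 (scalar 16) (scalar 17))

/-- The new vertex, in the scalar 17, gets the ancestors of its parent, in the scalar 16. -/
def copyColumn : SProg :=
  forLoop 13 (natStore 5 (scalar 13) (scalar 17) (.read 5 (scalar 13) (scalar 16)))

/-- Attach the vertex in the scalar 17 below the vertex in the scalar 16. -/
def attach : SProg :=
  seq (natStore 3 (scalar 17) (.lit 0) (.lit 1)) <|
  seq (natStore 4 (scalar 17) (.lit 0) (scalar 16)) <|
  seq (natStore 7 (scalar 16) (scalar 17) (.lit 1)) <|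
  seq (natStore 7 (scalar 17) (scalar 16) (.lit 1)) <|
  seq copyColumn (natStore 5 (scalar 17) (scalar 17) (.lit 1))

/-- Add a cheapest edge that leaves the current set, if there is one. -/
def primStep : SProg :=
  seq (argBest crossing cheaper) (ite (.nonzero (scalar 15)) attach skip)

/-- Prim's algorithm with the root `0`; the last round finds no edge. -/
def prim : SProg :=
  seq (natStore 3 (.lit 0) (.lit 0) (.lit 1)) (forLoop 10 primStep)

lemma copyColumn_spec {n : ℕ} {m : Memory} (hn : m.nat 0 0 0 = n) {x y : Fin n}
    (hx : m.nat 16 0 0 = x) (hy : m.nat 17 0 0 = y) (hxy : x ≠ y) (w v : Fin n) :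
    (copyColumn.run m).nat 5 w v = if v = y then m.nat 5 w x else m.nat 5 w v := by
  have := forLoop_induct (k := 13)
    (P := natStore 5 (scalar 13) (scalar 17) (.read 5 (scalar 13) (scalar 16))) hn
    (fun i m' => ∀ w v : Fin n, m'.nat 5 w v =
      if v = y ∧ w.val < i then m.nat 5 w x else m.nat 5 w v)
    (fun i m' v h => by simpa [setNat_nat] using h) (by simp) ?_
  · simpa [copyColumn] using this w v
  intro i hi m' hnat _ hi' hI w v
  have h16 : m'.nat 16 0 0 = x := by rw [hnat 16 (by simp [WritesNat]), hx]
  have h17 : m'.nat 17 0 0 = y := by rw [hnat 17 (by simp [WritesNat]), hy]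
  have hval := hI ⟨i, hi⟩ x
  rw [if_neg (fun h => hxy h.1)] at hval
  simp only at hval
  simp only [run, setNat_nat, NExp.eval, eval_scalar, hi', h16, h17, true_and, hval, hI w v,
    Fin.val_inj, Nat.lt_succ_iff_lt_or_eq]
  by_cases hv : v = y
  · rcases lt_trichotomy w.val i with h | h | h
    · simp [hv, h, h.ne]
    · obtain rfl : w = ⟨i, hi⟩ := Fin.ext h
      simp [hv]
    · simp [hv, h.ne', h.not_gt]
  · simp [hv]

/-- The memory represents a part of a rooted tree: its vertex set is in the array 3, the parents
are in the array 4, the relation `anc` is in the array 5, and the arcs, in both directions, are in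
the array 7. -/
structure HoldsTree {n : ℕ} (S : Set (Fin n)) (r : Fin n) (par : Fin n → Fin n)
    (anc : Fin n → Fin n → Prop) (m : Memory) : Prop where
  verts : ∀ v : Fin n, m.nat 3 v 0 ≠ 0 ↔ v ∈ S
  parent : ∀ v ∈ S, v ≠ r → m.nat 4 v 0 = par v
  ancestor : ∀ w v : Fin n, m.nat 5 w v ≠ 0 ↔ anc w v
  arcs : ∀ a b : Fin n, m.nat 7 a b ≠ 0 ↔
    ∃ v ∈ S, v ≠ r ∧ (a = v ∧ b = par v ∨ a = par v ∧ b = v)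

lemma HoldsTree.congr {n : ℕ} {S : Set (Fin n)} {r : Fin n} {par : Fin n → Fin n}
    {anc : Fin n → Fin n → Prop} {m m' : Memory} (h : HoldsTree S r par anc m)
    (h3 : m'.nat 3 = m.nat 3) (h4 : m'.nat 4 = m.nat 4) (h5 : m'.nat 5 = m.nat 5)
    (h7 : m'.nat 7 = m.nat 7) : HoldsTree S r par anc m' :=
  ⟨by rw [h3]; exact h.verts, by rw [h4]; exact h.parent, by rw [h5]; exact h.ancestor,
    by rw [h7]; exact h.arcs⟩

lemma attach_spec {n : ℕ} {m : Memory} (hn : m.nat 0 0 0 = n) {x y : Fin n}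
    (hx : m.nat 16 0 0 = x) (hy : m.nat 17 0 0 = y) {S : Set (Fin n)} {r : Fin n}
    {par : Fin n → Fin n} {anc : Fin n → Fin n → Prop} (h : HoldsTree S r par anc m)
    (ht : RootedTree S r par anc) (hxS : x ∈ S) (hyS : y ∉ S) :
    HoldsTree (insert y S) r (Function.update par y x)
      (fun w v => if v = y then w = y ∨ anc w x else anc w v) (attach.run m) := by
  have hxy : x ≠ y := fun e => hyS (e ▸ hxS)
  have hyr : y ≠ r := fun e => hyS (e ▸ ht.root_mem)
  have hpar : ∀ v ∈ S, Function.update par y x v = par v := fun v hv =>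
    Function.update_of_ne (by rintro rfl; exact hyS hv) _ _
  have h5 : ∀ m' : Memory, m'.nat 0 0 0 = n → m'.nat 16 0 0 = x → m'.nat 17 0 0 = y →
      ∀ w v : Fin n, (copyColumn.run m').nat 5 w v =
        if v = y then m'.nat 5 w x else m'.nat 5 w v :=
    fun m' h1 h2 h3 => copyColumn_spec h1 h2 h3 hxy
  have hcopy : ∀ a, a ≠ 5 → a ≠ 13 → ∀ m', (copyColumn.run m').nat a = m'.nat a :=
    fun a h1 h2 m' => run_nat _ (by simp [copyColumn, WritesNat, h1, h2]) m'
  constructor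
  · intro v
    simp [attach, run, setNat_nat, NExp.eval, hcopy, hx, hy, Fin.val_inj]
    by_cases hv : v = y
    · simp [hv]
    · simp only [hv, if_false, false_or]
      exact h.verts v
  · intro v hv hvr
    simp [attach, run, setNat_nat, NExp.eval, hcopy, hx, hy, Fin.val_inj]
    by_cases hvy : v = y
    · simp [hvy]
    · simp only [hvy, if_false]
      have hv := hv.resolve_left hvy
      rw [hpar v hv, h.parent v hv hvr]
  · intro w v
    simp only [attach, run]
    rw [setNat_nat]
    simp only [NExp.eval, eval_scalar]
    rw [h5]
    · simp [setNat_nat, hcopy, hx, hy, Fin.val_inj]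
      by_cases hv : v = y
      · by_cases hw : w = y
        · simp [hv, hw]
        · simp only [hv, hw, and_true, if_false, if_true, false_or]
          exact h.ancestor w x
      · simp only [hv, and_false, if_false]
        exact h.ancestor w v
    all_goals simp [setNat_nat, hn, hx, hy]
  · intro a b
    simp [attach, run, setNat_nat, NExp.eval, hcopy, hx, hy, Fin.val_inj]
    have hold := h.arcs a b
    constructor
    · intro h'
      by_cases h1 : a = y ∧ b = x
      · exact .inl ⟨hyr, .inl h1⟩
      by_cases h2 : a = x ∧ b = y
      · exact .inl ⟨hyr, .inr h2⟩
      have h' : m.nat 7 a b ≠ 0 := by simpa [h1, h2] using h'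
      obtain ⟨v, hv, hvr, hab⟩ := hold.1 h'
      refine .inr ⟨v, hv, hvr, ?_⟩
      rwa [hpar v hv]
    · intro h'
      by_cases h1 : a = y ∧ b = x
      · simp [h1]
      by_cases h2 : a = x ∧ b = y
      · simp [h2]
      · simp only [h1, h2, if_false]
        rcases h' with ⟨-, h' | h'⟩ | ⟨v, hv, hvr, hab⟩
        · exact absurd h' h1
        · exact absurd h' h2
        · rw [hpar v hv] at hab
          exact hold.2 ⟨v, hv, hvr, hab⟩

lemma prim_writesNat (k : ℕ) : prim.WritesNat k → k ∈ [3, 4, 5, 7, 10, 11, 12, 13, 15, 16, 17] := by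
  simp only [prim, primStep, attach, copyColumn, WritesNat, argBest_writesNat, List.mem_cons]
  tauto

lemma prim_writesReal (k : ℕ) : ¬ prim.WritesReal k := by
  simp [prim, primStep, attach, copyColumn, WritesReal, argBest_writesReal]

/-- After `prim`, the memory represents a rooted minimum spanning tree. -/
theorem prim_spec {n : ℕ} {G : SimpleGraph (Fin n)} {c : Sym2 (Fin n) → ℝ≥0} (hG : G.Connected)
    {m : Memory} (hm : HoldsInput G c m)
    (h0 : ∀ a, a = 3 ∨ a = 5 ∨ a = 7 → ∀ i j, m.nat a i j = 0) {r : Fin n} (hr : r.val = 0) :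
    ∃ par anc, PrimInv G c Set.univ r par anc ∧ HoldsTree Set.univ r par anc (prim.run m) := by
  classical
  have hn := hm.size
  rw [prim, run]
  set m₁ := (natStore 3 (.lit 0) (.lit 0) (.lit 1)).run m with hm₁
  have hm₁n : m₁.nat 0 0 0 = n := by
    rw [hm₁, run_nat _ (by simp [WritesNat]), hn]
  have main := forLoop_induct (k := 10) (P := primStep) hm₁n
    (fun i m' => ∃ S par anc, PrimInv G c S r par anc ∧ HoldsTree S r par anc m' ∧
      (i < S.ncard ∨ S = Set.univ)) ?_ ?_ ?_
  · obtain ⟨S, par, anc, h1, h2, h3⟩ := main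
    have hS : S = Set.univ := by
      refine h3.resolve_left fun h => ?_
      have := Set.ncard_le_card S
      rw [Nat.card_eq_fintype_card, Fintype.card_fin] at this
      omega
    subst hS
    exact ⟨par, anc, h1, h2⟩
  · rintro i m' v ⟨S, par, anc, h1, h2, h3⟩
    exact ⟨S, par, anc, h1, h2.congr (setNat_nat_of_ne _ (by simp) _ _ _)
      (setNat_nat_of_ne _ (by simp) _ _ _) (setNat_nat_of_ne _ (by simp) _ _ _)
      (setNat_nat_of_ne _ (by simp) _ _ _), h3⟩
  · obtain ⟨T, hT⟩ := exists_isMST (c := c) hG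
    refine ⟨{r}, fun _ => r, fun _ _ => False, ⟨⟨?_, ?_, ?_, ?_, ?_, ?_, ?_⟩, T, hT, ?_⟩,
      ⟨?_, ?_, ?_, ?_⟩, ?_⟩
    case refine_9 =>
      intro v
      simp [hm₁, run, setNat_nat, NExp.eval, h0 3, Fin.ext_iff, hr]
    case refine_11 =>
      intro w v
      simp [hm₁, run, setNat_nat, h0 5]
    case refine_12 =>
      intro w v
      simp [hm₁, run, setNat_nat, h0 7]
    all_goals simp
  rintro i hi m₂ hnat hreal - ⟨S, par, anc, hinv, hmem, hcard⟩
  have hm₁ag : ∀ a, a ≠ 3 → m₁.nat a = m.nat a := fun a ha => run_nat _ (by simpa [WritesNat]) _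
  have hag : ∀ a, a = 0 ∨ a = 1 → m₂.nat a = m.nat a := by
    rintro a (rfl | rfl) <;>
    rw [hnat _ (by
      simp [primStep, attach, copyColumn, WritesNat, argBest_writesNat]), hm₁ag _ (by simp)]
  have hm₂ : HoldsInput G c m₂ := hm.congr (hag 0 (by simp)) (hag 1 (by simp)) (by
    rw [hreal 0 (by simp [primStep, attach, copyColumn, WritesReal, argBest_writesReal]), hm₁]
    rfl)
  have hbest := argBest_spec (m := m₂) (fun x y => x ∈ S ∧ y ∉ S ∧ G.Adj x y)
    (fun x y => -(c s(x, y) : ℝ)) (cand := crossing) (better := cheaper) hm₂.size ?_ ?_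
  rotate_left
  · intro m' x y hag hx hy
    have h3 : m'.nat 3 = m₂.nat 3 := hag.1 3 (by simp) (by simp) (by simp) (by simp) (by simp)
    have h1 : m'.nat 1 = m₂.nat 1 := hag.1 1 (by simp) (by simp) (by simp) (by simp) (by simp)
    simp only [crossing, Test.Holds, Test.holds_nonzero, NExp.eval, eval_scalar, hx, hy, h3, h1]
    rw [hmem.verts, hmem.verts, hm₂.adj]
  · intro m' x y x' y' hag hx hy hx' hy' hC hC'
    simp only [cheaper, Test.Holds, RExp.eval, eval_scalar, hx, hy, hx', hy', hag.2]
    rw [hm₂.cost _ _ hC.2.2, hm₂.cost _ _ hC'.2.2, neg_le_neg_iff]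
  rw [primStep, run]
  set m₃ := (argBest crossing cheaper).run m₂ with hm₃
  have hm₃ag : ∀ a, ¬ (a = 11 ∨ a = 12 ∨ a = 15 ∨ a = 16 ∨ a = 17) → m₃.nat a = m₂.nat a :=
    fun a ha => run_nat _ (by rwa [argBest_writesNat]) _
  have hmem₃ : HoldsTree S r par anc m₃ := hmem.congr (hm₃ag 3 (by simp)) (hm₃ag 4 (by simp))
    (hm₃ag 5 (by simp)) (hm₃ag 7 (by simp))
  rw [run]
  rcases hbest with ⟨hf, hnone⟩ | ⟨hf, x, y, hx, hy, ⟨hxS, hyS, hxy⟩, hmin⟩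
  · rw [if_neg (by simpa using hf)]
    refine ⟨S, par, anc, hinv, hmem₃, .inr ?_⟩
    by_contra hS
    obtain ⟨v, hv⟩ := (Set.ne_univ_iff_exists_notMem S).1 hS
    obtain ⟨a, b, h⟩ := exists_crossing_edge hG hinv.tree.root_mem hv
    exact hnone a b trivial h
  · rw [if_pos (by simpa using hf)]
    refine ⟨_, _, _, hinv.insert hxS hyS hxy ?_, attach_spec (by
      rw [hm₃ag 0 (by simp), hm₂.size]) hx hy hmem₃ hinv.tree hxS hyS, .inl ?_⟩
    · intro a b ha hb hab
      simpa using hmin a b trivial ⟨ha, hb, hab⟩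
    · rw [Set.ncard_insert_of_notMem hyS]
      rcases hcard with h | h
      · omega
      · exact absurd (h ▸ trivial) hyS

end SProg

end

/-! ### Covering, gains and updates -/

section

/-- The two tests have the same truth value. -/
def Test.equiv (b b' : Test) : Test := .conj (.neg (.conj b (.neg b'))) (.neg (.conj b' (.neg b)))

@[simp] lemma Test.holds_equiv (m : Memory) (b b' : Test) :
    (Test.equiv b b').Holds m ↔ (b.Holds m ↔ b'.Holds m) := by
  simp only [Test.equiv, Test.Holds]; tauto

/-- `GreedyReach.step` for arbitrary decidability instances. -/
lemma GreedyReach.step_of_maximal {V : Type*} [Fintype V]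
    [DecidableEq (V × ℝ≥0)] [DecidableEq (V × V)] {G T : SimpleGraph V}
    {c : Sym2 V → ℝ≥0} {A : Finset (V × ℝ≥0)} {M : Finset (V × V)} {S : V × ℝ≥0}
    (h : GreedyReach G c T A M) (hlt : coverCost G c T A < treeCost c T) (hS : IsStar G c S)
    (hmax : ∀ S', IsStar G c S' → ratio G c T A S' ≤ ratio G c T A S) :
    GreedyReach G c T (insert S A) (M \ newArcs G c T A S) := by
  convert GreedyReach.step A M S h hlt hS hmax

/-- The memory represents the rooted tree and the values `A`, `M` of the variables of Greedy: the
covered edges are in the array 6, the arcs of `M` are in the array 7, and the arcs of the chosen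
stars are in the array 2. -/
structure HoldsState {n : ℕ} (G : SimpleGraph (Fin n)) (c : Sym2 (Fin n) → ℝ≥0)
    (T : SimpleGraph (Fin n)) (r : Fin n) (par : Fin n → Fin n) (anc : Fin n → Fin n → Prop)
    (A : Finset (Fin n × ℝ≥0)) (M : Finset (Fin n × Fin n)) (m : Memory) : Prop where
  input : HoldsInput G c m
  parent : ∀ v ≠ r, m.nat 4 v 0 = par v
  ancestor : ∀ w v : Fin n, m.nat 5 w v ≠ 0 ↔ anc w v
  covered : ∀ w ≠ r, m.nat 6 w 0 ≠ 0 ↔ s(w, par w) ∈ QAll G c T A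
  arcs : ∀ a b : Fin n, m.nat 7 a b ≠ 0 ↔ (a, b) ∈ M
  stars : ∀ a b : Fin n, m.nat 2 a b ≠ 0 ↔ ∃ S ∈ A, (a, b) ∈ starArcs G c S

variable {n : ℕ} {G T : SimpleGraph (Fin n)} {c : Sym2 (Fin n) → ℝ≥0} {r : Fin n}
  {par : Fin n → Fin n} {anc : Fin n → Fin n → Prop} {A : Finset (Fin n × ℝ≥0)}
  {M : Finset (Fin n × Fin n)} {m m' : Memory}

lemma HoldsState.congr (h : HoldsState G c T r par anc A M m)
    (hnat : ∀ a, a = 0 ∨ a = 1 ∨ a = 2 ∨ a = 4 ∨ a = 5 ∨ a = 6 ∨ a = 7 → m'.nat a = m.nat a)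
    (hreal : m'.real 0 = m.real 0) : HoldsState G c T r par anc A M m' := by
  refine ⟨h.input.congr ?_ ?_ hreal, ?_, ?_, ?_, ?_, ?_⟩
  · exact hnat 0 (by simp)
  · exact hnat 1 (by simp)
  · rw [hnat 4 (by simp)]; exact h.parent
  · rw [hnat 5 (by simp)]; exact h.ancestor
  · rw [hnat 6 (by simp)]; exact h.covered
  · rw [hnat 7 (by simp)]; exact h.arcs
  · rw [hnat 2 (by simp)]; exact h.stars

namespace SProg

/-- With `u`, `v` in the scalars `k`, `l`: the vertex in the scalar 14 belongs to the star
`S(u, c(uv))` and is separated from `u` by the parent edge of the vertex in the scalar 13. -/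
def separatesFrom (k l : ℕ) : Test :=
  .conj (.nonzero (.read 1 (scalar k) (scalar 14)))
    (.conj (.realLe (.read 0 (scalar k) (scalar 14)) (.read 0 (scalar k) (scalar l)))
      (.neg (.equiv (.nonzero (.read 5 (scalar 13) (scalar k)))
        (.nonzero (.read 5 (scalar 13) (scalar 14))))))

/-- Mark, in the array 8, the vertices whose parent edge is covered by the star `S(u, c(uv))`. -/
def coverStar (k l : ℕ) : SProg :=
  forLoop 13 (seq (natStore 8 (scalar 13) (.lit 0) (.lit 0))
    (forLoop 14 (ite (separatesFrom k l) (natStore 8 (scalar 13) (.lit 0) (.lit 1)) skip)))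

lemma coverStar_writesNat (k l a : ℕ) :
    (coverStar k l).WritesNat a ↔ a = 8 ∨ a = 13 ∨ a = 14 := by
  simp only [coverStar, WritesNat]; tauto

lemma coverStar_writesReal (k l a : ℕ) : ¬ (coverStar k l).WritesReal a := by
  simp [coverStar, WritesReal]

lemma coverStar_spec (hm : HoldsInput G c m)
    (hanc : ∀ w v : Fin n, m.nat 5 w v ≠ 0 ↔ anc w v) {k l : ℕ}
    (hk : k ≠ 8 ∧ k ≠ 13 ∧ k ≠ 14) (hl : l ≠ 8 ∧ l ≠ 13 ∧ l ≠ 14) {u v : Fin n}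
    (hu : m.nat k 0 0 = u) (hv : m.nat l 0 0 = v) (w : Fin n) :
    ((coverStar k l).run m).nat 8 w 0 ≠ 0 ↔
      ∃ z, G.Adj u z ∧ (c s(u, z) : ℝ) ≤ m.real 0 u v ∧ ¬ (anc w u ↔ anc w z) := by
  set R : Fin n → Fin n → Prop := fun w z =>
    G.Adj u z ∧ (c s(u, z) : ℝ) ≤ m.real 0 u v ∧ ¬ (anc w u ↔ anc w z) with hR
  have main := forLoop_induct (k := 13) (m := m) hm.size
    (P := (seq (natStore 8 (scalar 13) (.lit 0) (.lit 0))
    (forLoop 14 (ite (separatesFrom k l) (natStore 8 (scalar 13) (.lit 0) (.lit 1)) skip))))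
    (fun i m' => ∀ w : Fin n, w.val < i → (m'.nat 8 w 0 ≠ 0 ↔ ∃ z, R w z))
    (fun i m' v h => by simpa [setNat_nat] using h) (by simp) ?_
  · exact main w w.isLt
  intro i hi m₁ hnat₁ hreal₁ hi₁ hI
  rw [run]
  set m₂ := (natStore 8 (scalar 13) (.lit 0) (.lit 0)).run m₁ with hm₂
  have hnat₂ : ∀ a, a ≠ 8 → m₂.nat a = m₁.nat a := fun a ha => run_nat _ (by simpa [WritesNat]) _
  have hn₂ : m₂.nat 0 0 0 = n := by
    rw [hnat₂ 0 (by simp), hnat₁ 0 (by simp [WritesNat]), hm.size]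
  have inner := forLoop_induct (k := 14) (m := m₂) hn₂
    (P := ite (separatesFrom k l) (natStore 8 (scalar 13) (.lit 0) (.lit 1)) skip)
    (fun j m' => (∀ w : Fin n, w.val < i → (m'.nat 8 w 0 ≠ 0 ↔ ∃ z, R w z)) ∧
      (m'.nat 8 i 0 ≠ 0 ↔ ∃ z : Fin n, z.val < j ∧ R ⟨i, hi⟩ z))
    (fun i m' v h => by simpa [setNat_nat] using h) ?_ ?_
  · intro w hw
    rcases Nat.lt_succ_iff_lt_or_eq.1 hw with hw | hw
    · exact inner.1 w hw
    · obtain rfl : w = ⟨i, hi⟩ := Fin.ext hw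
      simpa using inner.2
  · constructor
    · intro w hw
      have := hI w hw
      simpa [hm₂, run, setNat_nat, NExp.eval, hi₁, hw.ne] using this
    · simp [hm₂, run, setNat_nat, NExp.eval, hi₁]
  intro j hj m₃ hnat₃ hreal₃ hj₃ ⟨h1, h2⟩
  have hnat : ∀ a, ¬ (a = 8 ∨ a = 13 ∨ a = 14) → m₃.nat a = m.nat a := by
    intro a ha
    simp only [not_or] at ha
    rw [hnat₃ a (by simp [WritesNat, ha]), hnat₂ a ha.1, hnat₁ a (by simp [WritesNat, ha])]
  have hreal : ∀ a, m₃.real a = m.real a := by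
    intro a
    rw [hreal₃ a (by simp [WritesReal]), hm₂, run_real _ (by simp [WritesReal]),
      hreal₁ a (by simp [WritesReal])]
  have hi₃ : m₃.nat 13 0 0 = i := by
    rw [hnat₃ 13 (by simp [WritesNat]), hnat₂ 13 (by simp), hi₁]
  have hk₃ : m₃.nat k 0 0 = u := by rw [hnat k (by simpa using hk), hu]
  have hl₃ : m₃.nat l 0 0 = v := by rw [hnat l (by simpa using hl), hv]
  have htest : (separatesFrom k l).Holds m₃ ↔ R ⟨i, hi⟩ ⟨j, hj⟩ := by
    simp only [separatesFrom, Test.Holds, Test.holds_nonzero, Test.holds_equiv, NExp.eval,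
      RExp.eval, eval_scalar, hi₃, hj₃, hk₃, hl₃, hreal, hnat 1 (by simp), hnat 5 (by simp), hR]
    rw [← hanc ⟨i, hi⟩, ← hanc ⟨i, hi⟩, hm.adj u ⟨j, hj⟩]
    refine and_congr_right fun hadj => ?_
    rw [hm.cost u ⟨j, hj⟩ hadj]
  have hsucc : (∃ z : Fin n, z.val < j + 1 ∧ R ⟨i, hi⟩ z) ↔
      (∃ z : Fin n, z.val < j ∧ R ⟨i, hi⟩ z) ∨ R ⟨i, hi⟩ ⟨j, hj⟩ := by
    constructor
    · rintro ⟨z, hz, hz'⟩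
      rcases Nat.lt_succ_iff_lt_or_eq.1 hz with hz | hz
      · exact .inl ⟨z, hz, hz'⟩
      · obtain rfl : z = ⟨j, hj⟩ := Fin.ext hz
        exact .inr hz'
    · rintro (⟨z, hz, hz'⟩ | h)
      · exact ⟨z, by omega, hz'⟩
      · exact ⟨_, by simp, h⟩
  rw [run]
  split_ifs with ht
  · rw [htest] at ht
    constructor
    · intro w hw
      simpa [run, setNat_nat, NExp.eval, hi₃, hw.ne] using h1 w hw
    · rw [hsucc]
      simp [run, setNat_nat, NExp.eval, hi₃, ht]
  · rw [htest] at ht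
    refine ⟨h1, ?_⟩
    rw [hsucc, run, h2]
    simp [ht]

/-- The mark set by `coverStar`, in terms of the tree. -/
lemma coverStar_iff (ht : RootedMST G c T r par anc) (hs : HoldsState G c T r par anc A M m)
    {k l : ℕ} (hk : k ≠ 8 ∧ k ≠ 13 ∧ k ≠ 14) (hl : l ≠ 8 ∧ l ≠ 13 ∧ l ≠ 14) {u v : Fin n}
    (hu : m.nat k 0 0 = u) (hv : m.nat l 0 0 = v) (huv : G.Adj u v) (w : Fin n) :
    ((coverStar k l).run m).nat 8 w 0 ≠ 0 ↔
      w ≠ r ∧ s(w, par w) ∈ QStar G c T (u, c s(u, v)) := by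
  rw [coverStar_spec hs.input hs.ancestor hk hl hu hv, hs.input.cost u v huv]
  by_cases hw : w = r
  · subst hw
    simp [ht.tree.anc_root]
  · rw [ht.mem_QStar_iff hw]
    simp [hw]

/-- The parent edge of the vertex in the scalar 13 is marked in the array 8 and not covered yet. -/
def newlyMarked : Test :=
  .conj (.nonzero (.read 8 (scalar 13) (.lit 0))) (.neg (.nonzero (.read 6 (scalar 13) (.lit 0))))

/-- Add the costs of the newly marked edges to the cell of the array 1 of reals given by the scalars
11 and 12. -/
def addGains : SProg :=
  forLoop 13 (ite newlyMarked
    (realStore 1 (scalar 11) (scalar 12) (.add (.read 1 (scalar 11) (scalar 12))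
      (.read 0 (scalar 13) (.read 4 (scalar 13) (.lit 0))))) skip)

/-- Compute the gains of all stars: the gain of `S(u, c(uv))` goes to the cell `(u, v)` of the array 1
of reals. The results for pairs `(u, v)` that are not adjacent are never used. -/
def gains : SProg :=
  forLoop 11 (forLoop 12 (seq (coverStar 11 12)
    (seq (realStore 1 (scalar 11) (scalar 12) .zero) addGains)))

lemma gains_writesNat (a : ℕ) :
    gains.WritesNat a ↔ a = 8 ∨ a = 11 ∨ a = 12 ∨ a = 13 ∨ a = 14 := by
  simp only [gains, addGains, WritesNat, coverStar_writesNat]; tauto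

lemma gains_writesReal (a : ℕ) : gains.WritesReal a ↔ a = 1 := by
  simp [gains, addGains, WritesReal, coverStar_writesReal]

lemma addGains_spec (hn : m.nat 0 0 0 = n) {x y : ℕ} (hx : m.nat 11 0 0 = x)
    (hy : m.nat 12 0 0 = y) :
    (∀ x' y', ¬ (x' = x ∧ y' = y) → (addGains.run m).real 1 x' y' = m.real 1 x' y') ∧
    (addGains.run m).real 1 x y = m.real 1 x y + ∑ w : Fin n,
      if m.nat 8 w 0 ≠ 0 ∧ m.nat 6 w 0 = 0 then m.real 0 w (m.nat 4 w 0) else 0 := by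
  rw [← Finset.sum_range
    (fun w => if m.nat 8 w 0 ≠ 0 ∧ m.nat 6 w 0 = 0 then m.real 0 w (m.nat 4 w 0) else 0)]
  refine forLoop_induct hn (fun i m' =>
    (∀ x' y', ¬ (x' = x ∧ y' = y) → m'.real 1 x' y' = m.real 1 x' y') ∧
    m'.real 1 x y = m.real 1 x y + ∑ w ∈ Finset.range i,
      if m.nat 8 w 0 ≠ 0 ∧ m.nat 6 w 0 = 0 then m.real 0 w (m.nat 4 w 0) else 0)
    (fun i m' v h => h) (by simp) ?_
  intro i hi m₁ hnat hreal hi₁ ⟨h1, h2⟩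
  have hnat : ∀ a, a ≠ 13 → m₁.nat a = m.nat a := fun a ha => hnat a (by simpa [WritesNat] using ha)
  have htest : newlyMarked.Holds m₁ ↔ m.nat 8 i 0 ≠ 0 ∧ m.nat 6 i 0 = 0 := by
    simp [newlyMarked, Test.Holds, NExp.eval, hi₁, hnat 8, hnat 6]
  rw [run]
  split_ifs with ht
  · rw [htest] at ht
    constructor
    · intro x' y' h
      simp only [run, setReal_real, eval_scalar, hnat 11 (by simp), hnat 12 (by simp), hx, hy, h,
        and_false, if_false]
      exact h1 x' y' h
    · rw [Finset.sum_range_succ, if_pos ht, ← add_assoc, ← h2]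
      simp [run, setReal_real, RExp.eval, NExp.eval, hnat 11, hnat 12, hx, hy, hi₁, hnat 4,
        hreal 0 (by simp [WritesReal])]
  · rw [htest] at ht
    refine ⟨h1, ?_⟩
    rw [Finset.sum_range_succ, if_neg ht, add_zero]
    exact h2

lemma gains_spec (ht : RootedMST G c T r par anc) (hs : HoldsState G c T r par anc A M m)
    {x y : Fin n} (hxy : G.Adj x y) :
    (gains.run m).real 1 x y = gain G c T A (x, c s(x, y)) := by
  have main := forLoop_induct (k := 11) (P := forLoop 12 (seq (coverStar 11 12)
    (seq (realStore 1 (scalar 11) (scalar 12) .zero) addGains))) hs.input.size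
    (fun i m' => ∀ x y : Fin n, x.val < i → G.Adj x y →
      m'.real 1 x y = gain G c T A (x, c s(x, y))) (fun i m' v h => h) (by simp) ?_
  · exact main x y x.isLt hxy
  intro i hi m₁ hnat₁ hreal₁ hi₁ hI
  have hs₁ : HoldsState G c T r par anc A M m₁ := by
    refine hs.congr (fun a ha => hnat₁ a ?_) (hreal₁ 0 ?_)
    · rcases ha with rfl | rfl | rfl | rfl | rfl | rfl | rfl <;>
        simp [addGains, WritesNat, coverStar_writesNat]
    · simp [addGains, WritesReal, coverStar_writesReal]
  have inner := forLoop_induct (k := 12) (P := seq (coverStar 11 12)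
    (seq (realStore 1 (scalar 11) (scalar 12) .zero) addGains)) hs₁.input.size
    (fun j m' => ∀ x y : Fin n, (x.val < i ∨ x.val = i ∧ y.val < j) → G.Adj x y →
      m'.real 1 x y = gain G c T A (x, c s(x, y))) (fun i m' v h => h) (by simpa using hI) ?_
  · intro x y hx
    exact inner x y (by omega)
  intro j hj m₂ hnat₂ hreal₂ hj₂ hI
  have hs₂ : HoldsState G c T r par anc A M m₂ := by
    refine hs₁.congr (fun a ha => hnat₂ a ?_) (hreal₂ 0 ?_)
    · rcases ha with rfl | rfl | rfl | rfl | rfl | rfl | rfl <;>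
        simp [addGains, WritesNat, coverStar_writesNat]
    · simp [addGains, WritesReal, coverStar_writesReal]
  have hi₂ : m₂.nat 11 0 0 = i := by
    rw [hnat₂ 11 (by simp [addGains, WritesNat, coverStar_writesNat]), hi₁]
  rw [run, run]
  set m₃ := (coverStar 11 12).run m₂ with hm₃
  have hnat₃ : ∀ a, ¬ (a = 8 ∨ a = 13 ∨ a = 14) → m₃.nat a = m₂.nat a := fun a ha =>
    run_nat _ (by rwa [coverStar_writesNat]) _
  have hreal₃ : ∀ a, m₃.real a = m₂.real a := fun a => run_real _ (coverStar_writesReal _ _ _) _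
  set m₄ := (realStore 1 (scalar 11) (scalar 12) .zero).run m₃ with hm₄
  have hnat₄ : m₄.nat = m₃.nat := rfl
  have hreal₄ : ∀ x' y', m₄.real 1 x' y' = if x' = i ∧ y' = j then 0 else m₂.real 1 x' y' := by
    intro x' y'
    simp [hm₄, run, setReal_real, RExp.eval, hnat₃ 11, hnat₃ 12, hi₂, hj₂, hreal₃]
  obtain ⟨h1, h2⟩ := addGains_spec (n := n) (m := m₄) (x := i) (y := j)
    (by rw [hnat₄, hnat₃ 0 (by simp), hs₂.input.size]) (by rw [hnat₄, hnat₃ 11 (by simp), hi₂])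
    (by rw [hnat₄, hnat₃ 12 (by simp), hj₂])
  intro x y hxy' hxy
  by_cases hne : x.val = i ∧ y.val = j
  · obtain rfl : x = ⟨i, hi⟩ := Fin.ext hne.1
    obtain rfl : y = ⟨j, hj⟩ := Fin.ext hne.2
    simp only
    rw [h2, hreal₄, if_pos ⟨rfl, rfl⟩, zero_add, ht.gain_eq_sum]
    refine Finset.sum_congr rfl fun w _ => ?_
    have hmark := coverStar_iff ht hs₂ (k := 11) (l := 12) (by simp) (by simp) hi₂ hj₂ hxy w
    have key : (m₄.nat 8 w 0 ≠ 0 ∧ m₄.nat 6 w 0 = 0) ↔ (w ≠ r ∧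
        s(w, par w) ∈ QStar G c T (⟨i, hi⟩, c s(⟨i, hi⟩, ⟨j, hj⟩)) ∧
          s(w, par w) ∉ QAll G c T A) := by
      rw [hnat₄, hmark, hnat₃ 6 (by simp), and_assoc]
      refine and_congr_right fun hw => and_congr_right fun _ => ?_
      rw [← hs₂.covered w hw, not_not]
    by_cases hc : m₄.nat 8 w 0 ≠ 0 ∧ m₄.nat 6 w 0 = 0
    · obtain ⟨hw, hc'⟩ := key.1 hc
      rw [if_pos hc, if_pos ⟨hw, hc'⟩, hnat₄, hnat₃ 4 (by simp), hs₂.parent w hw,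
        ← hs₂.input.cost _ _ (ht.mst.1.1 (ht.adj w hw)), ← hreal₃]
      simp [hm₄, run, setReal_real]
    · rw [if_neg hc, if_neg (fun h => hc (key.2 h))]
  · rw [h1 _ _ hne, hreal₄, if_neg hne]
    exact hI x y (by omega) hxy

/-- Cover the newly marked edges, and remove those of their arcs from the array 7 that lead away from
the vertex in the scalar 16. -/
def markEdges : SProg :=
  forLoop 13 (ite newlyMarked
    (seq (natStore 6 (scalar 13) (.lit 0) (.lit 1))
      (ite (.nonzero (.read 5 (scalar 13) (scalar 16)))
        (natStore 7 (scalar 13) (.read 4 (scalar 13) (.lit 0)) (.lit 0))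
        (natStore 7 (.read 4 (scalar 13) (.lit 0)) (scalar 13) (.lit 0)))) skip)

/-- With `u`, `v` in the scalars 16 and 17, add the arcs of the star `S(u, c(uv))` to the array 2. -/
def markStar : SProg :=
  forLoop 14 (ite (.conj (.nonzero (.read 1 (scalar 16) (scalar 14)))
      (.realLe (.read 0 (scalar 16) (scalar 14)) (.read 0 (scalar 16) (scalar 17))))
    (natStore 2 (scalar 16) (scalar 14) (.lit 1)) skip)

/-- Choose the star `S(u, c(uv))`, with `u`, `v` in the scalars 16 and 17. -/
def update : SProg := seq (coverStar 16 17) (seq markEdges markStar)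

lemma markStar_spec (hm : HoldsInput G c m) {u v : Fin n} (hu : m.nat 16 0 0 = u)
    (hv : m.nat 17 0 0 = v) (huv : G.Adj u v) (a b : Fin n) :
    (markStar.run m).nat 2 a b ≠ 0 ↔
      m.nat 2 a b ≠ 0 ∨ (a, b) ∈ starArcs G c (u, c s(u, v)) := by
  have main := forLoop_induct (k := 14)
    (P := ite (.conj (.nonzero (.read 1 (scalar 16) (scalar 14)))
      (.realLe (.read 0 (scalar 16) (scalar 14)) (.read 0 (scalar 16) (scalar 17))))
    (natStore 2 (scalar 16) (scalar 14) (.lit 1)) skip) hm.size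
    (fun i m' => ∀ a b : Fin n, m'.nat 2 a b ≠ 0 ↔
      m.nat 2 a b ≠ 0 ∨ (b.val < i ∧ (a, b) ∈ starArcs G c (u, c s(u, v))))
    (fun i m' v h => by simpa [setNat_nat] using h) (by simp) ?_
  · simpa [markStar] using main a b
  intro i hi m₁ hnat hreal hi₁ hI a b
  have hnat : ∀ a, a ≠ 2 → a ≠ 14 → m₁.nat a = m.nat a := fun a h h' =>
    hnat a (by simp [WritesNat, h, h'])
  have h16 : m₁.nat 16 0 0 = u := by rw [hnat 16 (by simp) (by simp), hu]
  have h17 : m₁.nat 17 0 0 = v := by rw [hnat 17 (by simp) (by simp), hv]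
  rw [run]
  have htest : (Test.conj (.nonzero (.read 1 (scalar 16) (scalar 14)))
      (.realLe (.read 0 (scalar 16) (scalar 14)) (.read 0 (scalar 16) (scalar 17)))).Holds m₁ ↔
      (u, (⟨i, hi⟩ : Fin n)) ∈ starArcs G c (u, c s(u, v)) := by
    simp only [Test.Holds, Test.holds_nonzero, NExp.eval, RExp.eval, eval_scalar, h16, h17, hi₁,
      hnat 1 (by simp) (by simp), hreal 0 (by simp [WritesReal]), mem_starArcs, true_and]
    rw [hm.adj u ⟨i, hi⟩, hm.cost u v huv]
    refine and_congr_right fun hadj => ?_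
    rw [hm.cost u ⟨i, hi⟩ hadj, NNReal.coe_le_coe]
  have hstar : ∀ a b, (a, b) ∈ starArcs G c (u, c s(u, v)) → a = u :=
    fun a b h => (mem_starArcs.1 h).1
  have hb : b.val < i + 1 ↔ b.val < i ∨ b = ⟨i, hi⟩ := by
    rw [Fin.ext_iff]; simp only; omega
  have hI := hI a b
  split_ifs with ht
  · rw [htest] at ht
    simp only [run, setNat_nat, NExp.eval, eval_scalar, h16, hi₁, true_and]
    by_cases hab : a = u ∧ b = ⟨i, hi⟩
    · simp [hab.1, hab.2, ht]
    · have : ¬ (a.val = u.val ∧ b.val = i) := by simpa [Fin.ext_iff] using hab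
      rw [if_neg this, hI, hb]
      refine or_congr_right (and_congr_left fun hs => ?_)
      have := hstar a b hs
      tauto
  · rw [htest] at ht
    rw [run, hI, hb]
    refine or_congr_right (and_congr_left fun hs => ?_)
    have h1 := hstar a b hs
    constructor
    · exact .inl
    · rintro (h | rfl)
      · exact h
      · rw [h1] at hs; exact absurd hs ht

lemma markEdges_spec (ht : RootedMST G c T r par anc) (hs : HoldsState G c T r par anc A M m)
    {u : Fin n} {S : Fin n × ℝ≥0} (hS : S.1 = u) (hu : m.nat 16 0 0 = u)
    (hmark : ∀ w : Fin n, m.nat 8 w 0 ≠ 0 ↔ w ≠ r ∧ s(w, par w) ∈ QStar G c T S) :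
    (∀ w ≠ r, (markEdges.run m).nat 6 w 0 ≠ 0 ↔
      s(w, par w) ∈ QStar G c T S ∨ s(w, par w) ∈ QAll G c T A) ∧
    ∀ a b : Fin n, (markEdges.run m).nat 7 a b ≠ 0 ↔
      (a, b) ∈ M ∧ (a, b) ∉ newArcs G c T A S := by
  set N : Fin n → Prop := fun w => w ≠ r ∧ s(w, par w) ∈ QStar G c T S ∧
    s(w, par w) ∉ QAll G c T A with hN
  set D : Fin n → Fin n → Fin n → Prop := fun w a b =>
    anc w S.1 ∧ a = w ∧ b = par w ∨ ¬ anc w S.1 ∧ a = par w ∧ b = w with hD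
  have main := forLoop_induct (k := 13)
    (P := ite newlyMarked
    (seq (natStore 6 (scalar 13) (.lit 0) (.lit 1))
      (ite (.nonzero (.read 5 (scalar 13) (scalar 16)))
        (natStore 7 (scalar 13) (.read 4 (scalar 13) (.lit 0)) (.lit 0))
        (natStore 7 (.read 4 (scalar 13) (.lit 0)) (scalar 13) (.lit 0)))) skip) hs.input.size
    (fun i m' => (∀ w : Fin n, m'.nat 6 w 0 ≠ 0 ↔ m.nat 6 w 0 ≠ 0 ∨ (w.val < i ∧ N w)) ∧
      ∀ a b : Fin n, m'.nat 7 a b ≠ 0 ↔ (a, b) ∈ M ∧ ¬ ∃ w : Fin n, w.val < i ∧ N w ∧ D w a b)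
    (fun i m' v h => by simpa [setNat_nat] using h) (by simpa using hs.arcs) ?_
  · refine ⟨fun w hw => ?_, fun a b => ?_⟩
    · rw [markEdges, main.1 w, hs.covered w hw]
      simp only [hN, hw, w.isLt, ne_eq, not_false_eq_true, true_and]
      tauto
    · rw [markEdges, main.2 a b, ht.mem_newArcs_iff]
      refine and_congr_right fun _ => not_congr (exists_congr fun w => ?_)
      simp only [hN, hD, w.isLt, true_and]
      tauto
  intro i hi m₁ hnat _ hi₁ ⟨h1, h2⟩
  have hnat : ∀ a, a ≠ 6 → a ≠ 7 → a ≠ 13 → m₁.nat a = m.nat a := fun a h h' h'' =>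
    hnat a (by simp [WritesNat, h, h', h''])
  have hlt : ∀ w : Fin n, w.val < i + 1 ↔ w.val < i ∨ w = ⟨i, hi⟩ := by
    intro w
    rw [Fin.ext_iff]; simp only; omega
  have htest : newlyMarked.Holds m₁ ↔ N ⟨i, hi⟩ := by
    have h6 := h1 ⟨i, hi⟩
    have h8 := hmark ⟨i, hi⟩
    simp only [lt_irrefl, false_and, or_false] at h6 h8
    simp only [newlyMarked, Test.Holds, Test.holds_nonzero, NExp.eval, eval_scalar, hi₁,
      hnat 8 (by simp) (by simp) (by simp), h6, h8, hN]
    rw [and_assoc]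
    refine and_congr_right fun hr => ?_
    have := hs.covered ⟨i, hi⟩ hr
    simp only at this
    rw [this]
  have hex : ∀ a b, (∃ w : Fin n, w.val < i + 1 ∧ N w ∧ D w a b) ↔
      (∃ w : Fin n, w.val < i ∧ N w ∧ D w a b) ∨ (N ⟨i, hi⟩ ∧ D ⟨i, hi⟩ a b) := by
    intro a b
    simp only [hlt, or_and_right, exists_or, exists_eq_left]
  rw [run]
  split_ifs with hmk
  · rw [htest] at hmk
    have hpar : m₁.nat 4 i 0 = par ⟨i, hi⟩ := by
      rw [hnat 4 (by simp) (by simp) (by simp)]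
      exact hs.parent ⟨i, hi⟩ hmk.1
    have hanc : m₁.nat 5 i u ≠ 0 ↔ anc ⟨i, hi⟩ u := by
      rw [hnat 5 (by simp) (by simp) (by simp)]
      exact hs.ancestor ⟨i, hi⟩ u
    have h16 : m₁.nat 16 0 0 = u := by
      rw [hnat 16 (by simp) (by simp) (by simp), hu]
    constructor
    · intro w
      have : ∀ P : Prop, [Decidable P] → ∀ k k' : ℕ, (if P then k else k') ≠ 0 ↔
          (P ∧ k ≠ 0 ∨ ¬ P ∧ k' ≠ 0) := by
        intro P _ k k'
        split_ifs with h <;> simp [h]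
      have h7 : ∀ (m' : Memory) (b : Test) (i j e i' j' e' : NExp),
          ((ite b (natStore 7 i j e) (natStore 7 i' j' e')).run m').nat 6 = m'.nat 6 :=
        fun m' b i j e i' j' e' => run_nat _ (by simp [WritesNat]) _
      rw [run, h7]
      simp only [run, setNat_nat, NExp.eval, eval_scalar, hi₁, true_and, and_true, this, h1 w, hlt]
      by_cases hw : w = ⟨i, hi⟩
      · simp [hw, hmk]
      · have : w.val ≠ i := fun h => hw (Fin.ext h)
        simp [hw, this]
    · intro a b
      rw [hex]
      have hDi : D ⟨i, hi⟩ a b ↔ (anc ⟨i, hi⟩ u ∧ a.val = i ∧ b = par ⟨i, hi⟩ ∨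
          ¬ anc ⟨i, hi⟩ u ∧ a = par ⟨i, hi⟩ ∧ b.val = i) := by
        simp [hD, hS, Fin.ext_iff]
      have h2 := h2 a b
      have htest' : (Test.nonzero (.read 5 (scalar 13) (scalar 16))).Holds
          ((natStore 6 (scalar 13) (.lit 0) (.lit 1)).run m₁) ↔ anc ⟨i, hi⟩ u := by
        rw [← hanc]
        simp [run, setNat_nat, NExp.eval, hi₁, h16]
      rw [run]
      by_cases h : anc ⟨i, hi⟩ u
      · rw [run_ite_of_pos (htest'.2 h)]
        simp only [run, setNat_nat, NExp.eval, eval_scalar, hi₁]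
        simp only [hDi, hmk, h, true_and, not_true, false_and, or_false]
        by_cases hab : a.val = i ∧ b = par ⟨i, hi⟩
        · simp [hab, hpar]
        · simpa [hab, hpar, Fin.val_inj] using h2
      · rw [run_ite_of_neg (fun h' => h (htest'.1 h'))]
        simp only [run, setNat_nat, NExp.eval, eval_scalar, hi₁]
        simp only [hDi, hmk, h, true_and, not_false_eq_true, false_and, false_or]
        by_cases hab : a = par ⟨i, hi⟩ ∧ b.val = i
        · simp [hab, hpar]
        · simpa [hab, hpar, Fin.val_inj] using h2
  · rw [htest] at hmk
    refine ⟨fun w => ?_, fun a b => ?_⟩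
    · rw [run, h1 w, hlt]
      refine or_congr_right (and_congr_left fun hN => ?_)
      constructor
      · exact .inl
      · rintro (h | rfl)
        exacts [h, absurd hN hmk]
    · rw [run, h2 a b, hex]
      simp [hmk]

end SProg

end

/-! ### The program for Greedy -/

section

variable {n : ℕ} {G T : SimpleGraph (Fin n)} {c : Sym2 (Fin n) → ℝ≥0} {r : Fin n}
  {par : Fin n → Fin n} {anc : Fin n → Fin n → Prop} {A : Finset (Fin n × ℝ≥0)}
  {M : Finset (Fin n × Fin n)} {m m' : Memory}

namespace SProg

open Classical in
lemma update_spec (ht : RootedMST G c T r par anc) (hs : HoldsState G c T r par anc A M m)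
    {u v : Fin n} (hu : m.nat 16 0 0 = u) (hv : m.nat 17 0 0 = v) (huv : G.Adj u v) :
    HoldsState G c T r par anc (insert (u, c s(u, v)) A)
      (M \ newArcs G c T A (u, c s(u, v))) (update.run m) := by
  rw [update, run, run]
  have hmark := coverStar_iff ht hs (k := 16) (l := 17) (by simp) (by simp) hu hv huv
  set m₁ := (coverStar 16 17).run m with hm₁
  have hnat₁ : ∀ a, ¬ (a = 8 ∨ a = 13 ∨ a = 14) → m₁.nat a = m.nat a := fun a ha =>
    run_nat _ (by rwa [coverStar_writesNat]) _
  have hreal₁ : ∀ a, m₁.real a = m.real a := fun a => run_real _ (coverStar_writesReal _ _ _) _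
  have hs₁ : HoldsState G c T r par anc A M m₁ := hs.congr (by
    rintro a (rfl | rfl | rfl | rfl | rfl | rfl | rfl) <;> exact hnat₁ _ (by simp)) (hreal₁ 0)
  obtain ⟨h6, h7⟩ := markEdges_spec ht hs₁ (S := (u, c s(u, v))) rfl
    (by rw [hnat₁ 16 (by simp), hu]) hmark
  set m₂ := markEdges.run m₁ with hm₂
  have hnat₂ : ∀ a, a ≠ 6 → a ≠ 7 → a ≠ 13 → m₂.nat a = m₁.nat a := fun a h h' h'' =>
    run_nat _ (by simp [markEdges, WritesNat, h, h', h'']) _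
  have hreal₂ : ∀ a, m₂.real a = m₁.real a := fun a =>
    run_real _ (by simp [markEdges, WritesReal]) _
  have hin₂ : HoldsInput G c m₂ := hs₁.input.congr (hnat₂ 0 (by simp) (by simp) (by simp))
    (hnat₂ 1 (by simp) (by simp) (by simp)) (hreal₂ 0)
  have h2 := markStar_spec hin₂ (u := u) (v := v)
    (by rw [hnat₂ 16 (by simp) (by simp) (by simp), hnat₁ 16 (by simp), hu])
    (by rw [hnat₂ 17 (by simp) (by simp) (by simp), hnat₁ 17 (by simp), hv]) huv
  have hnat₃ : ∀ a, a ≠ 2 → a ≠ 14 → (markStar.run m₂).nat a = m₂.nat a := fun a h h' =>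
    run_nat _ (by simp [markStar, WritesNat, h, h']) _
  refine ⟨hin₂.congr (hnat₃ 0 (by simp) (by simp)) (hnat₃ 1 (by simp) (by simp))
    (run_real _ (by simp [markStar, WritesReal]) _), ?_, ?_, ?_, ?_, ?_⟩
  · rw [hnat₃ 4 (by simp) (by simp), hnat₂ 4 (by simp) (by simp) (by simp)]
    exact hs₁.parent
  · rw [hnat₃ 5 (by simp) (by simp), hnat₂ 5 (by simp) (by simp) (by simp)]
    exact hs₁.ancestor
  · intro w hw
    rw [hnat₃ 6 (by simp) (by simp), h6 w hw, mem_QAll_insert]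
  · intro a b
    rw [hnat₃ 7 (by simp) (by simp), h7, Finset.mem_sdiff]
  · intro a b
    rw [h2, hnat₂ 2 (by simp) (by simp) (by simp), hs₁.stars a b]
    simp only [Finset.mem_insert, exists_eq_or_imp]
    exact or_comm

/-- The pair `(u, v)` in the scalars 11 and 12 is an edge of positive cost, and the star `S(u, c(uv))`
has positive gain. -/
def candidate : Test :=
  .conj (.nonzero (.read 1 (scalar 11) (scalar 12)))
    (.conj (.neg (.realLe (.read 0 (scalar 11) (scalar 12)) .zero))
      (.neg (.realLe (.read 1 (scalar 11) (scalar 12)) .zero)))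

/-- The ratio of the star in the scalars 11 and 12 is at least that of the star in the scalars 16 and
17, with the denominators cleared. -/
def betterRatio : Test :=
  .realMulLe (.read 1 (scalar 16) (scalar 17)) (.read 0 (scalar 11) (scalar 12))
    (.read 1 (scalar 11) (scalar 12)) (.read 0 (scalar 16) (scalar 17))

/-- Choose a star of maximum ratio among those with positive radius and positive gain; if there is
none, then all edges of positive cost are covered, and nothing happens. -/
def greedyStep : SProg :=
  seq gains (seq (argBest candidate betterRatio) (ite (.nonzero (scalar 15)) update skip))

/-- Add the arcs of `M` to the output. -/
def finish : SProg :=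
  forLoop 11 (forLoop 12 (ite (.nonzero (.read 7 (scalar 11) (scalar 12)))
    (natStore 2 (scalar 11) (scalar 12) (.lit 1)) skip))

/-- The program for Greedy. Every effective round of its main loop covers a new edge, so that `n`
rounds suffice. -/
def greedy : SProg := seq prim (seq (forLoop 10 greedyStep) finish)

lemma greedyStep_spec (ht : RootedMST G c T r par anc) (hs : HoldsState G c T r par anc A M m)
    (hr : GreedyReach G c T A M) : ∃ A' M', GreedyReach G c T A' M' ∧
      HoldsState G c T r par anc A' M' (greedyStep.run m) ∧
      (coverCost G c T A < treeCost c T ∧ (QAll G c T A).card < (QAll G c T A').card ∨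
        ¬ coverCost G c T A' < treeCost c T) := by
  classical
  rw [greedyStep, run, run]
  have hgain : ∀ x y : Fin n, G.Adj x y → (gains.run m).real 1 x y = gain G c T A (x, c s(x, y)) :=
    fun x y hxy => gains_spec ht hs hxy
  set m₁ := gains.run m with hm₁
  have hs₁ : HoldsState G c T r par anc A M m₁ := hs.congr (by
    rintro a (rfl | rfl | rfl | rfl | rfl | rfl | rfl) <;>
    exact run_nat _ (by simp [gains_writesNat]) _) (run_real _ (by simp [gains_writesReal]) _)
  have hbest := argBest_spec (m := m₁)
    (fun x y => G.Adj x y ∧ 0 < c s(x, y) ∧ 0 < gain G c T A (x, c s(x, y)))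
    (fun x y => gain G c T A (x, c s(x, y)) / c s(x, y))
    (cand := candidate) (better := betterRatio) hs₁.input.size ?_ ?_
  rotate_left
  · intro m' x y hag hx hy
    have h1 : m'.nat 1 = m₁.nat 1 := hag.1 1 (by simp) (by simp) (by simp) (by simp) (by simp)
    simp only [candidate, Test.Holds, Test.holds_nonzero, NExp.eval, RExp.eval, eval_scalar, hx,
      hy, h1, hag.2, not_le]
    rw [hs₁.input.adj]
    refine and_congr_right fun hxy => ?_
    rw [hs₁.input.cost x y hxy, hgain x y hxy, NNReal.coe_pos]
  · intro m' x y x' y' hag hx hy hx' hy' hC hC'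
    simp only [betterRatio, Test.Holds, RExp.eval, eval_scalar, hx, hy, hx', hy', hag.2]
    rw [hs₁.input.cost x y hC.1, hgain x y hC.1, hs₁.input.cost x' y' hC'.1, hgain x' y' hC'.1,
      div_le_div_iff₀ (NNReal.coe_pos.2 hC'.2.1) (NNReal.coe_pos.2 hC.2.1)]
  set m₂ := (argBest candidate betterRatio).run m₁ with hm₂
  have hs₂ : HoldsState G c T r par anc A M m₂ := hs₁.congr (by
    rintro a (rfl | rfl | rfl | rfl | rfl | rfl | rfl) <;>
    exact run_nat _ (by simp [argBest_writesNat]) _) (run_real _ (argBest_writesReal _ _ _) _)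
  rcases hbest with ⟨hf, hnone⟩ | ⟨hf, u, v, hu, hv, ⟨huv, hpos, hg⟩, hmax⟩
  · rw [run_ite_of_neg (by simpa using hf), run]
    refine ⟨A, M, hr, hs₂, .inr fun hlt => ?_⟩
    obtain ⟨x, y, hxy, hA, hp⟩ := exists_uncovered hlt
    have hle := cost_le_gain ht.mst.1 hxy hA
    exact hnone x y trivial ⟨ht.mst.1.1 hxy, hp, (NNReal.coe_pos.2 hp).trans_le hle⟩
  · rw [run_ite_of_pos (by simpa using hf)]
    have hins : coverCost G c T A < coverCost G c T (insert (u, c s(u, v)) A) := by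
      rw [← NNReal.coe_lt_coe, ← coverCost_add_gain]
      linarith
    have hlt := hins.trans_le (coverCost_le ht.mst.1.2 _)
    refine ⟨_, _, hr.step_of_maximal hlt ⟨v, huv, rfl⟩ ?_, update_spec ht hs₂ hu hv huv, .inl ⟨hlt, ?_⟩⟩
    · -- the stars that are not candidates have ratio at most one
      have hone : 1 ≤ ratio G c T A (u, c s(u, v)) := by
        obtain ⟨x, y, hxy, hA, hp⟩ := exists_uncovered hlt
        have hle := cost_le_gain ht.mst.1 hxy hA
        have hp' := NNReal.coe_pos.2 hp
        rw [ratio_of_pos hpos]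
        refine le_trans ?_ (hmax x y trivial ⟨ht.mst.1.1 hxy, hp, hp'.trans_le hle⟩)
        rwa [one_le_div hp']
      rintro ⟨x, ρ⟩ ⟨y, hxy, hρ⟩
      simp only at hxy hρ
      subst hρ
      rcases (zero_le : 0 ≤ c s(x, y)).eq_or_lt with h0 | hp
      · exact (ratio_le_one h0.symm).trans hone
      · rcases (gain_nonneg (G := G) (c := c) (T := T) A (x, c s(x, y))).eq_or_lt with h0 | hg'
        · rw [ratio_of_pos hp, ← h0, zero_div]
          linarith
        · rw [ratio_of_pos hp, ratio_of_pos hpos]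
          exact hmax x y trivial ⟨hxy, hp, hg'⟩
    · have hsub : QAll G c T A ⊆ QAll G c T (insert (u, c s(u, v)) A) :=
        fun e he => mem_QAll_insert.2 (.inr he)
      refine Finset.card_lt_card (hsub.ssubset_of_ne fun he => hins.ne ?_)
      rw [coverCost, coverCost, ← he]

lemma greedyLoop_spec (ht : RootedMST G c T r par anc)
    (hs : HoldsState G c T r par anc ∅ (bidirected T) m) :
    ∃ A M, GreedyReach G c T A M ∧ ¬ coverCost G c T A < treeCost c T ∧
      HoldsState G c T r par anc A M ((forLoop 10 greedyStep).run m) := by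
  have main := forLoop_induct (k := 10) (P := greedyStep) hs.input.size
    (fun i m' => ∃ A M, GreedyReach G c T A M ∧ HoldsState G c T r par anc A M m' ∧
      (i ≤ (QAll G c T A).card ∨ ¬ coverCost G c T A < treeCost c T)) ?_ ?_ ?_
  · obtain ⟨A, M, h1, h2, h3⟩ := main
    refine ⟨A, M, h1, h3.resolve_left fun h => ?_, h2⟩
    classical
    have hcard := ht.mst.1.2.card_edgeFinset
    have hle : (QAll G c T A).card ≤ T.edgeFinset.card := by
      refine Finset.card_le_card fun e he => ?_
      rw [SimpleGraph.mem_edgeFinset]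
      exact mem_edges.1 (QAll_subset ht.mst.1.2 A he)
    rw [Fintype.card_fin] at hcard
    omega
  · rintro i m' v ⟨A, M, h1, h2, h3⟩
    exact ⟨A, M, h1, h2.congr (by
      rintro a (rfl | rfl | rfl | rfl | rfl | rfl | rfl) <;>
      exact setNat_nat_of_ne _ (by simp) _ _ _) rfl, h3⟩
  · exact ⟨∅, _, .init, hs, .inl (Nat.zero_le _)⟩
  · rintro i hi m' - - - ⟨A, M, h1, h2, h3⟩
    obtain ⟨A', M', h1', h2', h3'⟩ := greedyStep_spec ht h2 h1
    refine ⟨A', M', h1', h2', ?_⟩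
    rcases h3' with ⟨hlt, hc⟩ | h
    · rcases h3 with h | h
      · exact .inl (by omega)
      · exact absurd hlt h
    · exact .inr h

lemma finish_spec (hn : m.nat 0 0 0 = n) (a b : Fin n) :
    (finish.run m).nat 2 a b ≠ 0 ↔ m.nat 2 a b ≠ 0 ∨ m.nat 7 a b ≠ 0 := by
  have main := forLoop_induct (k := 11)
    (P := forLoop 12 (ite (.nonzero (.read 7 (scalar 11) (scalar 12)))
      (natStore 2 (scalar 11) (scalar 12) (.lit 1)) skip)) hn
    (fun i m' => ∀ a b : Fin n, m'.nat 2 a b ≠ 0 ↔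
      m.nat 2 a b ≠ 0 ∨ (a.val < i ∧ m.nat 7 a b ≠ 0))
    (fun i m' v h => by simpa [setNat_nat] using h) (by simp) ?_
  · simpa [finish] using main a b
  intro i hi m₁ hnat₁ _ hi₁ hI
  have hnat₁ : ∀ a, a ≠ 2 → a ≠ 11 → a ≠ 12 → m₁.nat a = m.nat a := fun a h h' h'' =>
    hnat₁ a (by simp [WritesNat, h, h', h''])
  have inner := forLoop_induct (k := 12) (m := m₁) (n := n)
    (P := ite (.nonzero (.read 7 (scalar 11) (scalar 12)))
      (natStore 2 (scalar 11) (scalar 12) (.lit 1)) skip)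
    (by rw [hnat₁ 0 (by simp) (by simp) (by simp), hn])
    (fun j m' => ∀ a b : Fin n, m'.nat 2 a b ≠ 0 ↔
      m.nat 2 a b ≠ 0 ∨ ((a.val < i ∨ a.val = i ∧ b.val < j) ∧ m.nat 7 a b ≠ 0))
    (fun i m' v h => by simpa [setNat_nat] using h) (by simpa using hI) ?_
  · intro a b
    rw [inner a b]
    refine or_congr_right (and_congr_left fun _ => ?_)
    have := b.isLt
    omega
  intro j hj m₂ hnat₂ _ hj₂ hI a b
  have h11 : m₂.nat 11 0 0 = i := by rw [hnat₂ 11 (by simp [WritesNat]), hi₁]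
  have h7 : m₂.nat 7 = m.nat 7 := by
    rw [hnat₂ 7 (by simp [WritesNat]), hnat₁ 7 (by simp) (by simp) (by simp)]
  have htest : (Test.nonzero (.read 7 (scalar 11) (scalar 12))).Holds m₂ ↔ m.nat 7 i j ≠ 0 := by
    simp [NExp.eval, h11, hj₂, h7]
  have hI := hI a b
  have hlt : (a.val < i ∨ a.val = i ∧ b.val < j + 1) ↔
      (a.val < i ∨ a.val = i ∧ b.val < j) ∨ (a.val = i ∧ b.val = j) := by omega
  by_cases ht : m.nat 7 i j ≠ 0
  · rw [run_ite_of_pos (htest.2 ht), run, setNat_nat, eval_scalar, eval_scalar, h11, hj₂, hlt]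
    by_cases hab : a.val = i ∧ b.val = j
    · simp [hab, ht, NExp.eval]
    · simpa [hab] using hI
  · rw [run_ite_of_neg (fun h => ht (htest.1 h)), run, hI, hlt]
    refine or_congr_right (and_congr_left fun h => ?_)
    constructor
    · exact .inl
    · rintro (h' | ⟨h1, h2⟩)
      · exact h'
      · rw [h1, h2] at h; exact absurd h ht

lemma outputArcs_greedy (hG : G.Connected) :
    IsGreedyOutput G c (outputArcs n (greedy.run (inputMemory G c))) := by
  classical
  obtain ⟨v⟩ := hG.nonempty
  have hpos : 0 < n := v.pos
  have hin := holdsInput_inputMemory G c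
  have hzero : ∀ a, a ≠ 0 → a ≠ 1 → ∀ i j, (inputMemory G c).nat a i j = 0 := by
    intro a h0 h1 i j
    simp [inputMemory, h0, h1]
  obtain ⟨par, anc, hinv, hmem⟩ := prim_spec hG hin (r := ⟨0, hpos⟩)
    (fun a ha => hzero a (by rintro rfl; simp at ha) (by rintro rfl; simp at ha)) rfl
  obtain ⟨T, hT⟩ := hinv.rootedMST
  rw [greedy, run, run]
  set m₁ := prim.run (inputMemory G c) with hm₁
  have hnat₁ : ∀ a, a ∉ [3, 4, 5, 7, 10, 11, 12, 13, 15, 16, 17] →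
      m₁.nat a = (inputMemory G c).nat a := fun a ha =>
    run_nat _ (fun h => ha (prim_writesNat a h)) _
  have hs₁ : HoldsState G c T ⟨0, hpos⟩ par anc ∅ (bidirected T) m₁ := by
    refine ⟨hin.congr (hnat₁ 0 (by simp)) (hnat₁ 1 (by simp)) (run_real _ (prim_writesReal 0) _),
      fun v hv => hmem.parent v trivial hv, hmem.ancestor, ?_, ?_, ?_⟩
    · intro w _
      rw [hnat₁ 6 (by simp), hzero 6 (by simp) (by simp)]
      simp [QAll]
    · intro a b
      rw [hmem.arcs, mem_bidirected]
      constructor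
      · rintro ⟨w, -, hw, ⟨rfl, rfl⟩ | ⟨rfl, rfl⟩⟩
        exacts [hT.adj _ hw, (hT.adj _ hw).symm]
      · intro hab
        obtain ⟨w, hw, he⟩ := hT.exists_eq (e := s(a, b)) hab
        exact ⟨w, trivial, hw, Sym2.eq_iff.1 he⟩
    · intro a b
      rw [hnat₁ 2 (by simp), hzero 2 (by simp) (by simp)]
      simp
  obtain ⟨A, M, hr, hend, hs₂⟩ := greedyLoop_spec hT hs₁
  refine ⟨T, hT.mst, A, M, hr, hend, ?_⟩
  ext ⟨a, b⟩
  simp only [outputArcs, Finset.mem_filter, Finset.mem_univ, true_and, Finset.mem_union,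
    Finset.mem_biUnion]
  rw [finish_spec hs₂.input.size, hs₂.stars, hs₂.arcs]

end SProg

end

end MinPower


theorem theorem1 :
    -- every output of Greedy is feasible, and has power at most `β(1/2) · opt ≤ 1.85 · opt`
    (∀ (V : Type*) [Fintype V] (G : SimpleGraph V) (c : Sym2 V → NNReal), G.Connected →
      ∃ opt : NNReal, MinPower.IsOpt G c opt ∧
        ∀ H : Finset (V × V), MinPower.IsGreedyOutput G c H →
          MinPower.IsSolution G H ∧
          (MinPower.power c H : ℝ) ≤ MinPower.beta (1 / 2) * (opt : ℝ) ∧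
          MinPower.beta (1 / 2) * (opt : ℝ) ≤ 1.85 * (opt : ℝ)) ∧
    -- Greedy is carried out, in polynomial time, by one program, which is thus an algorithm of
    -- approximation ratio 1.85
    (∃ (P : MinPower.Prog) (q : Polynomial ℕ),
      ∀ (n : ℕ) (G : SimpleGraph (Fin n)) (c : Sym2 (Fin n) → NNReal), G.Connected →
        ∃ (t : ℕ) (m : MinPower.Memory),
          MinPower.Exec P (MinPower.inputMemory G c) t m ∧
          t ≤ q.eval n ∧
          MinPower.IsGreedyOutput G c (MinPower.outputArcs n m) ∧
          MinPower.IsSolution G (MinPower.outputArcs n m) ∧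
          ∃ opt : NNReal, MinPower.IsOpt G c opt ∧
            (MinPower.power c (MinPower.outputArcs n m) : ℝ) ≤ 1.85 * (opt : ℝ)) := by
  have hbeta : ∀ opt : ℝ≥0, MinPower.beta (1 / 2) * (opt : ℝ) ≤ 1.85 * (opt : ℝ) := fun opt =>
    mul_le_mul_of_nonneg_right MinPower.beta_half_le opt.coe_nonneg
  refine ⟨fun V _ G c hG => ?_, MinPower.SProg.greedy.compile, MinPower.SProg.greedy.time,
    fun n G c hG => ?_⟩
  · obtain ⟨opt, hopt⟩ := MinPower.exists_isOpt (c := c) hG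
    exact ⟨opt, hopt, fun H hH => ⟨hH.isSolution, hH.power_le hopt, hbeta opt⟩⟩
  · obtain ⟨t, ht, hexec⟩ := MinPower.SProg.exists_exec MinPower.SProg.greedy (by
      simp [MinPower.SProg.greedy, MinPower.SProg.prim, MinPower.SProg.primStep,
        MinPower.SProg.attach, MinPower.SProg.copyColumn, MinPower.SProg.greedyStep,
        MinPower.SProg.gains, MinPower.SProg.addGains, MinPower.SProg.coverStar,
        MinPower.SProg.update, MinPower.SProg.markEdges, MinPower.SProg.markStar,
        MinPower.SProg.finish, MinPower.SProg.LoopsOK, MinPower.SProg.WritesNat,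
        MinPower.SProg.argBest_loopsOK, MinPower.SProg.argBest_writesNat]) (by
      simp [MinPower.SProg.greedy, MinPower.SProg.prim, MinPower.SProg.primStep,
        MinPower.SProg.attach, MinPower.SProg.copyColumn, MinPower.SProg.greedyStep,
        MinPower.SProg.gains, MinPower.SProg.addGains, MinPower.SProg.coverStar,
        MinPower.SProg.update, MinPower.SProg.markEdges, MinPower.SProg.markStar,
        MinPower.SProg.finish, MinPower.SProg.WritesNat,
        MinPower.SProg.argBest_writesNat]) (MinPower.inputMemory G c)
    have hout := MinPower.SProg.outputArcs_greedy (c := c) hG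
    obtain ⟨opt, hopt⟩ := MinPower.exists_isOpt (c := c) hG
    refine ⟨t, _, hexec, ?_, hout, hout.isSolution, opt, hopt,
      (hout.power_le hopt).trans (hbeta opt)⟩
    rwa [(MinPower.holdsInput_inputMemory G c).size] at ht
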